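/- Let $\mathbb F_q$ be a finite field, let $\epsilon\in\mathbb F_q$ be a fixed non-square (so $q$ is odd), and let $l\ge 1$. Index the standard basis of $\mathbb F_q^{2l}$ by $1,-1,2,\dots,l,-2,\dots,-l$, write $e_{a,b}$ for the matrix units, and put $$\beta=\begin{pmatrix}\beta_0&0&0\\0&0&I_{l-1}\\0&I_{l-1}&0\end{pmatrix},\quad \beta_0=\begin{pmatrix}1&0\\0&\epsilon\end{pmatrix},\qquad \mathrm O^-(2l,q)=\{g\in \mathrm{GL}(2l,q)\mid {}^Tg\beta g=\beta\}.$$ For $u$ with $\beta(u,u)\ne0$ let $\rho_u(v)=v-2\frac{\beta(u,v)}{\beta(u,u)}u$. The spinor norm of $g=\rho_{u_1}\cdots\rho_{u_k}$ is the coset $\Theta(g)=\prod_i\tfrac12\beta(u_i,u_i)\cdot\mathbb F_q^{\times2}$; such a factorization of $g$ exists, and the coset does not depend on it. The elementary matrices are, for $r\in\mathbb F_q$ and $i,j\in\{2,\dots,l\}$, $$\begin{aligned} x_{i,j}(r)&=I+r(e_{i,j}-e_{-j,-i})\quad(i\ne j),\\ x_{i,-j}(r)&=I+r(e_{i,-j}-e_{j,-i})\quad(i<j),\\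 x_{-i,j}(r)&=I+r(e_{-i,j}-e_{-j,i})\quad(i<j),\\ x_{i,1}(r)&=I+r(e_{1,i}-e_{-i,1})-\tfrac{r^2}2e_{-i,i},\\ x_{1,i}(r)&=I+r(e_{i,1}-e_{1,-i})-\tfrac{r^2}2e_{i,-i},\\ x_{i,-1}(r)&=I+r(e_{-1,i}-\epsilon e_{-i,-1})-\tfrac{\epsilon r^2}2e_{-i,i},\\ x_{-1,i}(r)&=I+r(\epsilon e_{i,-1}-e_{-1,-i})-\tfrac{\epsilon r^2}2e_{i,-i},\\ w_i&=I-e_{i,i}-e_{-i,-i}-e_{i,-i}-e_{-i,i}. \end{aligned}$$ An output of Gaussian elimination on $g$ is a block diagonal matrix $$\mathrm{diag}\bigl(A_0,\;\mathrm{diag}(1,\dots,1,\lambda),\;\mathrm{diag}(1,\dots,1,\lambda^{-1})\bigr),\qquad A_0\in M_2(\mathbb F_q),\ \lambda\in\mathbb F_q^\times$$ (with $\lambda=1$ if $l=1$) obtained from $g$ by finitely many multiplications, on the left or on the right, by elementary matrices. Let $N$ be the number of these multiplications in which the factor is one of the $w_i$. Let $g\in\mathrm O^-(2l,q)$. Then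 Gaussian elimination on $g$ has an output. For every output, obtained with $N$ uses of the $w_i$, we have $\det g=\pm1$, and there are $t,s\in\mathbb F_q$ with $t^2+\epsilon s^2=1$ such that the following holds. * If $\det g=(-1)^{N+1}$, then $A_0=\begin{pmatrix}t&\epsilon s\\s&-t\end{pmatrix}$, and $\Theta(g)=\lambda(1-t)\,\mathbb F_q^{\times2}$ when $t\ne1$, while $\Theta(g)=2\epsilon\lambda\,\mathbb F_q^{\times2}$ when $t=1$. * If $\det g=(-1)^{N}$, then $A_0=\begin{pmatrix}t&-\epsilon s\\s&t\end{pmatrix}$, and $\Theta(g)=2\epsilon\lambda(1-t)\,\mathbb F_q^{\times2}$ when $t\ne1$, while $\Theta(g)=\lambda\,\mathbb F_q^{\times2}$ when $t=1$. -/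

import Mathlib

open Matrix

section SpinorNorm

variable {F : Type*} [Field F] {n : Type*} [Fintype n] [DecidableEq n]

/-- The value `β(u, v) = ᵗu B v` of the bilinear form with matrix `B`. -/
def formVal (B : Matrix n n F) (u v : n → F) : F := u ⬝ᵥ (B *ᵥ v)

/-- The matrix of the reflection `ρ_u(v) = v - 2 (β(u,v) / β(u,u)) u`. -/
def reflectionMatrix (B : Matrix n n F) (u : n → F) : Matrix n n F :=
  1 - (2 / formVal B u u) • vecMulVec u (u ᵥ* B)

/-- The coset `c F^{×2}`, as a set of elements of `F`. -/
def sqCoset (c : F) : Set F := {y | ∃ x : F, x ≠ 0 ∧ y = c * x ^ 2}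

/-- The spinor norm of `g` with respect to the form with matrix `B`, a coset of `F^{×2}` in `F^×`:
the set of all scalars lying in a coset `(∏ β(uᵢ,uᵢ)/2) F^{×2}`, where `g = ρ_{u₁} ⋯ ρ_{u_k}` is a
factorization of `g` into reflections in anisotropic vectors.

All factorizations contribute to the set. Hence, for `c ≠ 0`, the equation
`spinorNorm B g = sqCoset c` says that `g` has such a factorization and that every such
factorization gives the class of `c`. -/
def spinorNorm (B : Matrix n n F) (g : Matrix n n F) : Set F :=
  {y | ∃ us : List (n → F), (∀ u ∈ us, formVal B u u ≠ 0) ∧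
      g = (us.map (reflectionMatrix B)).prod ∧
      y ∈ sqCoset (us.map fun u => formVal B u u / 2).prod}

end SpinorNorm

section Twisted

/-- The index set of the basis `e₁, e₋₁, e₂, …, e_l, e₋₂, …, e₋_l`, where `l = m + 1`. The elements
of the two copies of `Fin m` are the indices `2, …, l` and `-2, …, -l`. -/
abbrev TwIdx (m : ℕ) : Type := Fin 2 ⊕ (Fin m ⊕ Fin m)

/-- The index `1`. -/
abbrev idxOne (m : ℕ) : TwIdx m := Sum.inl 0

/-- The index `-1`. -/
abbrev idxNegOne (m : ℕ) : TwIdx m := Sum.inl 1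

/-- The index `i` in the range `2, …, l`. -/
abbrev idxPos {m : ℕ} (i : Fin m) : TwIdx m := Sum.inr (Sum.inl i)

/-- The index `-i`, for `i` in the range `2, …, l`. -/
abbrev idxNeg {m : ℕ} (i : Fin m) : TwIdx m := Sum.inr (Sum.inr i)

variable {F : Type*} [Field F]

/-- The matrix of the form: `diag(1, ε)` on `e₁, e₋₁`, and `(0, I; I, 0)` on the other basis
vectors. -/
def twistedForm (ε : F) (m : ℕ) : Matrix (TwIdx m) (TwIdx m) F :=
  fromBlocks !![1, 0; 0, ε] 0 0 (fromBlocks 0 1 1 0)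

/-- The twisted orthogonal group `O⁻(2l, q)`, with `l = m + 1`. -/
def twistedOrthogonalGroup (ε : F) (m : ℕ) : Subgroup (GL (TwIdx m) F) where
  carrier := {g | (g : Matrix (TwIdx m) (TwIdx m) F)ᵀ * twistedForm ε m *
    (g : Matrix (TwIdx m) (TwIdx m) F) = twistedForm ε m}
  one_mem' := by simp
  mul_mem' := by
    intro a b ha hb
    simp only [Set.mem_ofPred_eq] at ha hb ⊢
    calc ((a * b : GL (TwIdx m) F) : Matrix (TwIdx m) (TwIdx m) F)ᵀ * twistedForm ε m *
          ((a * b : GL (TwIdx m) F) : Matrix (TwIdx m) (TwIdx m) F)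
        = (b : Matrix (TwIdx m) (TwIdx m) F)ᵀ * ((a : Matrix (TwIdx m) (TwIdx m) F)ᵀ *
          twistedForm ε m * (a : Matrix (TwIdx m) (TwIdx m) F)) *
          (b : Matrix (TwIdx m) (TwIdx m) F) := by
          simp only [Units.val_mul, transpose_mul, Matrix.mul_assoc]
      _ = twistedForm ε m := by rw [ha, hb]
  inv_mem' := by
    intro a ha
    simp only [Set.mem_ofPred_eq] at ha ⊢
    have h1 : (a : Matrix (TwIdx m) (TwIdx m) F) *
        ((a⁻¹ : GL (TwIdx m) F) : Matrix (TwIdx m) (TwIdx m) F) = 1 := by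
      rw [← Units.val_mul, mul_inv_cancel, Units.val_one]
    have h2 : ((a⁻¹ : GL (TwIdx m) F) : Matrix (TwIdx m) (TwIdx m) F)ᵀ *
        (a : Matrix (TwIdx m) (TwIdx m) F)ᵀ = 1 := by
      rw [← transpose_mul, h1, transpose_one]
    calc ((a⁻¹ : GL (TwIdx m) F) : Matrix (TwIdx m) (TwIdx m) F)ᵀ * twistedForm ε m *
          ((a⁻¹ : GL (TwIdx m) F) : Matrix (TwIdx m) (TwIdx m) F)
        = (((a⁻¹ : GL (TwIdx m) F) : Matrix (TwIdx m) (TwIdx m) F)ᵀ *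
          (a : Matrix (TwIdx m) (TwIdx m) F)ᵀ) * twistedForm ε m *
          ((a : Matrix (TwIdx m) (TwIdx m) F) *
          ((a⁻¹ : GL (TwIdx m) F) : Matrix (TwIdx m) (TwIdx m) F)) := by
          conv_lhs => rw [← ha]
          simp only [Matrix.mul_assoc]
      _ = twistedForm ε m := by rw [h1, h2, Matrix.one_mul, Matrix.mul_one]

/-- The matrix unit `e_{a,b}`. -/
abbrev matUnit {m : ℕ} (a b : TwIdx m) : Matrix (TwIdx m) (TwIdx m) F := Matrix.single a b 1

/-- The unipotent elementary matrices of `O⁻(2l, q)`. -/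
inductive IsElementary (ε : F) {m : ℕ} : Matrix (TwIdx m) (TwIdx m) F → Prop
  /-- `x_{i,j}(t)` -/
  | pos_pos (i j : Fin m) (hij : i ≠ j) (t : F) : IsElementary ε
      (1 + t • (matUnit (idxPos i) (idxPos j) - matUnit (idxNeg j) (idxNeg i)))
  /-- `x_{i,-j}(t)` -/
  | pos_neg (i j : Fin m) (hij : i < j) (t : F) : IsElementary ε
      (1 + t • (matUnit (idxPos i) (idxNeg j) - matUnit (idxPos j) (idxNeg i)))
  /-- `x_{-i,j}(t)` -/
  | neg_pos (i j : Fin m) (hij : i < j) (t : F) : IsElementary ε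
      (1 + t • (matUnit (idxNeg i) (idxPos j) - matUnit (idxNeg j) (idxPos i)))
  /-- `x_{i,1}(t)` -/
  | pos_one (i : Fin m) (t : F) : IsElementary ε
      (1 + t • (matUnit (idxOne m) (idxPos i) - matUnit (idxNeg i) (idxOne m))
        - (t ^ 2 / 2) • matUnit (idxNeg i) (idxPos i))
  /-- `x_{1,i}(t)` -/
  | one_pos (i : Fin m) (t : F) : IsElementary ε
      (1 + t • (matUnit (idxPos i) (idxOne m) - matUnit (idxOne m) (idxNeg i))
        - (t ^ 2 / 2) • matUnit (idxPos i) (idxNeg i))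
  /-- `x_{i,-1}(t)` -/
  | pos_negOne (i : Fin m) (t : F) : IsElementary ε
      (1 + t • (matUnit (idxNegOne m) (idxPos i) - ε • matUnit (idxNeg i) (idxNegOne m))
        - (ε * t ^ 2 / 2) • matUnit (idxNeg i) (idxPos i))
  /-- `x_{-1,i}(t)` -/
  | negOne_pos (i : Fin m) (t : F) : IsElementary ε
      (1 + t • (ε • matUnit (idxPos i) (idxNegOne m) - matUnit (idxNegOne m) (idxNeg i))
        - (ε * t ^ 2 / 2) • matUnit (idxPos i) (idxNeg i))

/-- The elementary matrix `w_i`, which interchanges `e_i` and `e₋ᵢ` up to sign. -/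
def elemW {m : ℕ} (i : Fin m) : Matrix (TwIdx m) (TwIdx m) F :=
  1 - matUnit (idxPos i) (idxPos i) - matUnit (idxNeg i) (idxNeg i)
    - matUnit (idxPos i) (idxNeg i) - matUnit (idxNeg i) (idxPos i)

/-- `Reduces ε g N h`: a finite sequence of elementary row and column operations, exactly `N` of
which are multiplications by matrices `w_i`, transforms `g` into `h`. -/
inductive Reduces (ε : F) {m : ℕ} (g : Matrix (TwIdx m) (TwIdx m) F) :
    ℕ → Matrix (TwIdx m) (TwIdx m) F → Prop
  | refl : Reduces ε g 0 g
  | row {N : ℕ} {h x : Matrix (TwIdx m) (TwIdx m) F} (hr : Reduces ε g N h)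
      (hx : IsElementary ε x) : Reduces ε g N (x * h)
  | col {N : ℕ} {h x : Matrix (TwIdx m) (TwIdx m) F} (hr : Reduces ε g N h)
      (hx : IsElementary ε x) : Reduces ε g N (h * x)
  | rowW {N : ℕ} {h : Matrix (TwIdx m) (TwIdx m) F} (hr : Reduces ε g N h)
      (i : Fin m) : Reduces ε g (N + 1) (elemW i * h)
  | colW {N : ℕ} {h : Matrix (TwIdx m) (TwIdx m) F} (hr : Reduces ε g N h)
      (i : Fin m) : Reduces ε g (N + 1) (h * elemW i)

/-- The diagonal `m × m` matrix `diag(1, …, 1, c)`. -/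
def lastDiag (m : ℕ) (c : F) : Matrix (Fin m) (Fin m) F :=
  diagonal fun i => if (i : ℕ) + 1 = m then c else 1

/-- The block diagonal matrix with blocks `A₀`, `diag(1, …, 1, lam)`, `diag(1, …, 1, lam⁻¹)`. -/
def outputMatrix {m : ℕ} (A₀ : Matrix (Fin 2) (Fin 2) F) (lam : Fˣ) :
    Matrix (TwIdx m) (TwIdx m) F :=
  fromBlocks A₀ 0 0
    (fromBlocks (lastDiag m (lam : F)) 0 0 (lastDiag m ((lam⁻¹ : Fˣ) : F)))

/-- Gaussian elimination, with `N` uses of the matrices `w_i`, reduces `g` to the block diagonal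
matrix with blocks `A₀`, `diag(1, …, 1, lam)`, `diag(1, …, 1, lam⁻¹)`. When `m = 0` the last two
blocks are empty and `lam` is `1` by convention. -/
def IsGaussianOutput (ε : F) {m : ℕ} (g : Matrix (TwIdx m) (TwIdx m) F) (N : ℕ)
    (A₀ : Matrix (Fin 2) (Fin 2) F) (lam : Fˣ) : Prop :=
  (m = 0 → lam = 1) ∧ Reduces ε g N (outputMatrix A₀ lam)

end Twisted

/-! ### Arithmetic of the bilinear form. -/

section FormVal

variable {F : Type*} [Field F] {n : Type*} [Fintype n]

/-! Every elementary matrix other than `w_i` is a Siegel transformation. It has determinant 1 and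
trivial spinor norm, because it is a product of reflections whose mirror vectors can be chosen with
norms multiplying to a square. Each `w_i` is the reflection in `e_i + e_{-i}`, of norm 2, so it
changes the sign of the determinant but also has trivial spinor norm under the normalization
`β(u,u)/2`. Hence elimination preserves the spinor norm and multiplies the determinant by `(-1)^N`
(`Reduces.det_eq`, `Reduces.hasSpinorClass`), and only the output has to be examined.

The output splits. On the last hyperbolic plane, `diag(λ, λ⁻¹)` is a product of reflections in
vectors of norms 2 and 2λ, which contributes λ. The block `A₀` is orthogonal for `diag(1, ε)`. If
its determinant is -1 it is a reflection, with mirror `(t-1, s)`, or `e_{-1}` when `t = 1`; if its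
determinant is 1 and `t ≠ 1`, it is such a reflection times `diag(1, -1)`.

The spinor norm is independent of the factorization because it can be read from a permutation sign.
A reflection permutes the unit sphere of the form, and a count modulo 4 shows that it acts oddly
exactly when the norm of its mirror vector is a square (`sign_reflectionPerm`). The determinant
gives the parity of the number of reflections, so the sign determines the quadratic character of the
product of norms, hence its square class over a finite field (`exists_prod_formVal_eq_mul_sq`).

An output exists because Siegel transformations, acting on the left only, bring the hyperbolic pairs
one after another to diagonal form (`exists_elim`); no `w_i` is needed. -/

lemma formVal_add_left (B : Matrix n n F) (u v w : n → F) :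
    formVal B (u + v) w = formVal B u w + formVal B v w := by
  simp [formVal, add_dotProduct]

lemma formVal_add_right (B : Matrix n n F) (u v w : n → F) :
    formVal B u (v + w) = formVal B u v + formVal B u w := by
  simp [formVal, mulVec_add, dotProduct_add]

lemma formVal_smul_left (B : Matrix n n F) (c : F) (u v : n → F) :
    formVal B (c • u) v = c * formVal B u v := by
  simp [formVal]

lemma formVal_smul_right (B : Matrix n n F) (c : F) (u v : n → F) :
    formVal B u (c • v) = c * formVal B u v := by
  simp [formVal, mulVec_smul]

lemma formVal_neg_left (B : Matrix n n F) (u v : n → F) :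
    formVal B (-u) v = -formVal B u v := by
  simp [formVal]

lemma formVal_neg_right (B : Matrix n n F) (u v : n → F) :
    formVal B u (-v) = -formVal B u v := by
  simp [formVal, mulVec_neg]

lemma formVal_sub_left (B : Matrix n n F) (u v w : n → F) :
    formVal B (u - v) w = formVal B u w - formVal B v w := by
  simp [sub_eq_add_neg, formVal_add_left, formVal_neg_left]

lemma formVal_sub_right (B : Matrix n n F) (u v w : n → F) :
    formVal B u (v - w) = formVal B u v - formVal B u w := by
  simp [sub_eq_add_neg, formVal_add_right, formVal_neg_right]

lemma formVal_zero_left (B : Matrix n n F) (v : n → F) : formVal B 0 v = 0 := by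
  simp [formVal]

lemma formVal_zero_right (B : Matrix n n F) (v : n → F) : formVal B v 0 = 0 := by
  simp [formVal]

lemma formVal_comm {B : Matrix n n F} (hB : B.IsSymm) (u v : n → F) :
    formVal B u v = formVal B v u := by
  rw [formVal, formVal, dotProduct_comm, dotProduct_mulVec v, ← mulVec_transpose, hB.eq]

lemma formVal_mulVec (B g : Matrix n n F) (u v : n → F) :
    formVal B (g *ᵥ u) (g *ᵥ v) = formVal (gᵀ * B * g) u v := by
  simp only [formVal, ← mulVec_mulVec, dotProduct_mulVec, vecMul_transpose]

lemma mulVec_ext {A A' : Matrix n n F} (h : ∀ x, A *ᵥ x = A' *ᵥ x) : A = A' :=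
  mulVec_injective (funext h)

lemma matrix_eq_of_formVal [DecidableEq n] {B B' : Matrix n n F}
    (h : ∀ u v, formVal B u v = formVal B' u v) :
    B = B' := by
  ext i j
  simpa [formVal] using h (Pi.single i 1) (Pi.single j 1)

lemma transpose_mul_mul_eq_iff [DecidableEq n] {B g : Matrix n n F} :
    gᵀ * B * g = B ↔ ∀ u v, formVal B (g *ᵥ u) (g *ᵥ v) = formVal B u v := by
  simp only [formVal_mulVec]
  exact ⟨fun h u v => by rw [h], matrix_eq_of_formVal⟩

lemma prod_formVal_div_two_ne_zero (h2 : (2 : F) ≠ 0) {B : Matrix n n F} {us : List (n → F)}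
    (hus : ∀ u ∈ us, formVal B u u ≠ 0) : (us.map fun u => formVal B u u / 2).prod ≠ 0 := by
  induction us with
  | nil => simp
  | cons u us ih =>
    rw [List.map_cons, List.prod_cons]
    exact mul_ne_zero (div_ne_zero (hus u (by simp)) h2) (ih fun v hv => hus v (by simp [hv]))

end FormVal

/-! ### Reflections. -/

section Reflection

variable {F : Type*} [Field F] {n : Type*} [Fintype n] [DecidableEq n]

lemma reflectionMatrix_mulVec (B : Matrix n n F) (u x : n → F) :
    reflectionMatrix B u *ᵥ x = x - (2 / formVal B u u * formVal B u x) • u := by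
  rw [reflectionMatrix, sub_mulVec, one_mulVec, smul_mulVec, vecMulVec_mulVec,
    ← dotProduct_mulVec, op_smul_eq_smul, smul_smul]
  rfl

lemma reflectionMatrix_mulVec_mulVec (B : Matrix n n F) (u x : n → F) :
    reflectionMatrix B u *ᵥ (reflectionMatrix B u *ᵥ x) = x := by
  simp only [reflectionMatrix_mulVec, formVal_sub_right, formVal_smul_right]
  -- For isotropic `u` the coefficient `2 / 0` is `0`, so the matrix is the identity.
  by_cases h : formVal B u u = 0
  · simp [h]
  · rw [sub_sub, ← add_smul]
    convert sub_zero x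
    convert zero_smul F u
    field_simp
    ring

lemma reflectionMatrix_mul_self (B : Matrix n n F) (u : n → F) :
    reflectionMatrix B u * reflectionMatrix B u = 1 :=
  mulVec_ext fun x => by
    rw [← mulVec_mulVec, reflectionMatrix_mulVec_mulVec, one_mulVec]

lemma formVal_reflectionMatrix {B : Matrix n n F} (hB : B.IsSymm) (u x y : n → F) :
    formVal B (reflectionMatrix B u *ᵥ x) (reflectionMatrix B u *ᵥ y) = formVal B x y := by
  simp only [reflectionMatrix_mulVec, formVal_sub_right, formVal_smul_right, formVal_sub_left,
    formVal_smul_left, formVal_comm hB x u]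
  by_cases h : formVal B u u = 0
  · simp [h]
  · field_simp
    ring

lemma det_reflectionMatrix {B : Matrix n n F} {u : n → F} (hu : formVal B u u ≠ 0) :
    (reflectionMatrix B u).det = -1 := by
  have h : reflectionMatrix B u = 1 + replicateCol Unit (-(2 / formVal B u u) • u) *
      replicateRow Unit (u ᵥ* B) := by
    rw [reflectionMatrix, vecMulVec_eq Unit]
    ext i j
    simp [mul_apply, sub_eq_add_neg, mul_assoc]
  rw [h, det_one_add_replicateCol_mul_replicateRow, dotProduct_smul, ← dotProduct_mulVec]
  change 1 + -(2 / formVal B u u) * formVal B u u = -1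
  field_simp
  ring

end Reflection

/-! ### Free actions of the Klein four-group. -/

section KleinCount

/-- A finite set with a free action of the Klein four-group has cardinality divisible by `4`. -/
lemma four_dvd_card_of_involutions {α : Type*} [DecidableEq α] (S : Finset α) (σ τ : α → α)
    (hσ : ∀ x, σ (σ x) = x) (hτ : ∀ x, τ (τ x) = x) (hστ : ∀ x, σ (τ x) = τ (σ x))
    (hSσ : ∀ x ∈ S, σ x ∈ S) (hSτ : ∀ x ∈ S, τ x ∈ S)
    (h1 : ∀ x ∈ S, σ x ≠ x) (h2 : ∀ x ∈ S, τ x ≠ x) (h3 : ∀ x ∈ S, σ (τ x) ≠ x) :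
    4 ∣ S.card := by
  -- `f` sends a point to its orbit, so its fibres over `S` are the orbits, each of four elements.
  let f : α → Finset α := fun x => {x, σ x, τ x, σ (τ x)}
  rw [Finset.card_eq_sum_card_image f S]
  refine Finset.dvd_sum fun b hb => ?_
  obtain ⟨a, ha, rfl⟩ := Finset.mem_image.1 hb
  have hfib : {x ∈ S | f x = f a} = f a := by
    ext x
    simp only [Finset.mem_filter]
    constructor
    · rintro ⟨-, h⟩
      rw [← h]
      simp [f]
    · intro h
      simp only [f, Finset.mem_insert, Finset.mem_singleton] at h
      rcases h with rfl | rfl | rfl | rfl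
      · exact ⟨ha, rfl⟩
      · refine ⟨hSσ _ ha, ?_⟩
        ext y
        simp only [f, Finset.mem_insert, Finset.mem_singleton, ← hστ, hσ]
        tauto
      · refine ⟨hSτ _ ha, ?_⟩
        ext y
        simp only [f, Finset.mem_insert, Finset.mem_singleton, hτ]
        tauto
      · refine ⟨hSσ _ (hSτ _ ha), ?_⟩
        ext y
        simp only [f, Finset.mem_insert, Finset.mem_singleton, ← hστ, hσ, hτ]
        tauto
  rw [hfib]
  have e1 : a ≠ σ a := (h1 a ha).symm
  have e2 : a ≠ τ a := (h2 a ha).symm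
  have e3 : a ≠ σ (τ a) := (h3 a ha).symm
  have e4 : σ a ≠ τ a := fun h => h3 a ha (by rw [← h, hσ])
  have e5 : σ a ≠ σ (τ a) := fun h => e2 (Function.Involutive.injective hσ h)
  have e6 : τ a ≠ σ (τ a) := (h1 _ (hSτ a ha)).symm
  have : (f a).card = 4 := by
    simp only [f]
    rw [Finset.card_insert_of_notMem, Finset.card_insert_of_notMem,
      Finset.card_insert_of_notMem, Finset.card_singleton] <;> simp [e1, e2, e3, e4, e5, e6]
  rw [this]

end KleinCount

/-! ### The spinor norm is well defined: permutation signs on the unit sphere. -/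

section SphereSign

variable {F : Type*} [Field F] {n : Type*} [Fintype n] [DecidableEq n]

/-- The action of a reflection on the unit sphere of the form. -/
def reflectionPerm {B : Matrix n n F} (hB : B.IsSymm) (u : n → F) :
    Equiv.Perm {v : n → F // formVal B v v = 1} :=
  Function.Involutive.toPerm
    (fun v => ⟨reflectionMatrix B u *ᵥ v.1, by rw [formVal_reflectionMatrix hB, v.2]⟩)
    fun v => Subtype.ext (reflectionMatrix_mulVec_mulVec B u v.1)

lemma reflectionPerm_apply {B : Matrix n n F} (hB : B.IsSymm) (u : n → F)
    (v : {v : n → F // formVal B v v = 1}) :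
    (reflectionPerm hB u v).1 = reflectionMatrix B u *ᵥ v.1 := rfl

lemma prod_reflectionPerm_apply {B : Matrix n n F} (hB : B.IsSymm) (us : List (n → F))
    (v : {v : n → F // formVal B v v = 1}) :
    ((us.map (reflectionPerm hB)).prod v).1 = (us.map (reflectionMatrix B)).prod *ᵥ v.1 := by
  induction us with
  | nil => simp
  | cons u us ih =>
    rw [List.map_cons, List.prod_cons, List.map_cons, List.prod_cons, Equiv.Perm.mul_apply,
      reflectionPerm_apply, ih, mulVec_mulVec]

lemma reflectionMatrix_mulVec_eq_self_iff (h2 : (2 : F) ≠ 0) {B : Matrix n n F} {u : n → F}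
    (hu : formVal B u u ≠ 0) (x : n → F) :
    reflectionMatrix B u *ᵥ x = x ↔ formVal B u x = 0 := by
  have hu0 : u ≠ 0 := by rintro rfl; simp [formVal_zero_left] at hu
  rw [reflectionMatrix_mulVec, sub_eq_self, smul_eq_zero]
  simp [hu0, h2, hu]

open Classical in
/-- The sign of a reflection acting on the unit sphere determines the square class of its
vector. -/
lemma sign_reflectionPerm [Fintype F] (h2 : (2 : F) ≠ 0) {B : Matrix n n F}
    (hB : B.IsSymm) {u : n → F} (hu : formVal B u u ≠ 0) :
    Equiv.Perm.sign (reflectionPerm hB u) = if IsSquare (formVal B u u) then -1 else 1 := by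
  have hu0 : u ≠ 0 := by rintro rfl; simp [formVal_zero_left] at hu
  have hinv : reflectionPerm hB u ^ 2 = 1 := by
    rw [pow_two]
    ext1 v
    exact Subtype.ext (reflectionMatrix_mulVec_mulVec B u v.1)
  rw [Equiv.Perm.sign_of_pow_two_eq_one hinv]
  -- The points moved by the reflection. It is an involution, so its sign is `(-1)^(|S|/2)`, and
  -- `|S|` is needed modulo 4.
  let S : Finset (n → F) := {v | formVal B v v = 1 ∧ formVal B u v ≠ 0}
  have hcard : Fintype.card {v : n → F // formVal B v v = 1} -
      Fintype.card (Function.fixedPoints (reflectionPerm hB u)) = S.card := by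
    rw [← Set.toFinset_card, ← Finset.card_compl]
    refine Finset.card_bij (fun v _ => v.1) ?_ (fun a _ b _ h => Subtype.ext h) ?_
    · intro v hv
      have : ¬ reflectionPerm hB u v = v := by simpa [Function.IsFixedPt] using hv
      rw [Subtype.ext_iff, reflectionPerm_apply, reflectionMatrix_mulVec_eq_self_iff h2 hu] at this
      simpa [S] using ⟨v.2, this⟩
    · intro v hv
      simp only [S, Finset.mem_filter, Finset.mem_univ, true_and] at hv
      refine ⟨⟨v, hv.1⟩, ?_, rfl⟩
      suffices ¬ reflectionPerm hB u ⟨v, hv.1⟩ = ⟨v, hv.1⟩ by simpa [Function.IsFixedPt] using this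
      rw [Subtype.ext_iff, reflectionPerm_apply, reflectionMatrix_mulVec_eq_self_iff h2 hu]
      exact hv.2
  rw [hcard]
  -- Off the line `F u`, the group generated by `-1` and `ρ_u` acts freely on `S`: `ρ_u` fixes only
  -- vectors orthogonal to `u`, and `-ρ_u` fixes only multiples of `u`.
  have hdiv : 4 ∣ {v ∈ S | ¬ ∃ a : F, v = a • u}.card := by
    have hneg : ∀ x : n → F, -x = x → x = 0 := fun x hx => by
      have : (2 : F) • x = 0 := by
        rw [two_smul]
        nth_rewrite 1 [← hx]
        simp
      exact (smul_eq_zero.1 this).resolve_left h2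
    refine four_dvd_card_of_involutions _ (fun x => -x) (fun x => reflectionMatrix B u *ᵥ x)
      (fun x => neg_neg x) (reflectionMatrix_mulVec_mulVec B u) (fun x => (mulVec_neg _ _).symm)
      ?_ ?_ ?_ ?_ ?_
    · intro x hx
      simp only [S, Finset.mem_filter, Finset.mem_univ, true_and] at hx ⊢
      refine ⟨⟨by simp [formVal_neg_left, formVal_neg_right, hx.1.1],
        by simp [formVal_neg_right, hx.1.2]⟩, ?_⟩
      rintro ⟨a, ha⟩
      exact hx.2 ⟨-a, by rw [neg_smul, ← ha, neg_neg]⟩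
    · intro x hx
      simp only [S, Finset.mem_filter, Finset.mem_univ, true_and] at hx ⊢
      refine ⟨⟨by rw [formVal_reflectionMatrix hB, hx.1.1], ?_⟩, ?_⟩
      · rw [reflectionMatrix_mulVec, formVal_sub_right, formVal_smul_right]
        convert neg_ne_zero.2 hx.1.2 using 1
        field_simp
        ring
      · rintro ⟨a, ha⟩
        rw [reflectionMatrix_mulVec, sub_eq_iff_eq_add, ← add_smul] at ha
        exact hx.2 ⟨_, ha⟩
    · intro x hx h
      simp only [S, Finset.mem_filter, Finset.mem_univ, true_and] at hx
      exact hx.1.2 (by rw [hneg x h, formVal_zero_right])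
    · intro x hx h
      simp only [S, Finset.mem_filter, Finset.mem_univ, true_and] at hx
      exact hx.1.2 ((reflectionMatrix_mulVec_eq_self_iff h2 hu x).1 h)
    · intro x hx h
      simp only [S, Finset.mem_filter, Finset.mem_univ, true_and] at hx
      rw [reflectionMatrix_mulVec, neg_sub, sub_eq_iff_eq_add, ← two_smul F x] at h
      refine hx.2 ⟨2⁻¹ * (2 / formVal B u u * formVal B u x), ?_⟩
      rw [mul_smul, h, smul_smul, inv_mul_cancel₀ h2, one_smul]
  -- A multiple `a • u` lies on the sphere iff `a² β(u,u) = 1`, which has two solutions or none.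
  have hline : {v ∈ S | ∃ a : F, v = a • u}.card = if IsSquare (formVal B u u) then 2 else 0 := by
    split_ifs with hsq
    · obtain ⟨d, hd⟩ := hsq
      have hd0 : d ≠ 0 := by rintro rfl; simp [hd] at hu
      have : {v ∈ S | ∃ a : F, v = a • u} = {d⁻¹ • u, -(d⁻¹ • u)} := by
        ext v
        simp only [S, Finset.mem_filter, Finset.mem_univ, true_and, Finset.mem_insert,
          Finset.mem_singleton]
        constructor
        · rintro ⟨⟨h, -⟩, a, rfl⟩
          rw [formVal_smul_left, formVal_smul_right, hd] at h
          have : (a * d) ^ 2 = 1 := by rw [← h]; ring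
          rcases eq_or_eq_neg_of_sq_eq_sq _ _ (this.trans (one_pow 2).symm) with h' | h'
          · left; rw [eq_inv_of_mul_eq_one_left h']
          · right
            rw [← neg_smul, ← eq_inv_of_mul_eq_one_left (a := -a) (b := d)
              (by linear_combination -h'), neg_neg]
        · rintro (rfl | rfl)
          · refine ⟨⟨?_, ?_⟩, _, rfl⟩
            · rw [formVal_smul_left, formVal_smul_right, hd]; field_simp
            · rw [formVal_smul_right]; exact mul_ne_zero (inv_ne_zero hd0) hu
          · refine ⟨⟨?_, ?_⟩, -d⁻¹, by simp⟩
            · rw [formVal_neg_left, formVal_neg_right, formVal_smul_left, formVal_smul_right, hd]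
              field_simp
            · rw [formVal_neg_right, formVal_smul_right]
              exact neg_ne_zero.2 (mul_ne_zero (inv_ne_zero hd0) hu)
      rw [this, Finset.card_pair]
      intro h
      have h3 : (2 * d⁻¹) • u = 0 := by
        rw [mul_smul, two_smul]
        nth_rewrite 1 [h]
        simp
      simp [h2, hd0, hu0] at h3
    · rw [Finset.card_eq_zero, Finset.filter_eq_empty_iff]
      rintro v hv ⟨a, rfl⟩
      simp only [S, Finset.mem_filter, Finset.mem_univ, true_and] at hv
      refine hsq ⟨a⁻¹, ?_⟩
      rw [formVal_smul_left, formVal_smul_right] at hv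
      have ha : a ≠ 0 := by rintro rfl; simp at hv
      field_simp
      linear_combination hv.1
  rw [← Finset.card_filter_add_card_filter_not (s := S) (fun v => ∃ a : F, v = a • u), hline]
  obtain ⟨k, hk⟩ := hdiv
  rw [hk]
  split_ifs
  · rw [show (2 + 4 * k) / 2 = 2 * k + 1 by lia, pow_succ, pow_mul]
    simp
  · rw [show (0 + 4 * k) / 2 = 2 * k by lia, pow_mul]
    simp

lemma det_prod_reflectionMatrix {B : Matrix n n F} {us : List (n → F)}
    (hus : ∀ u ∈ us, formVal B u u ≠ 0) :
    (us.map (reflectionMatrix B)).prod.det = (-1) ^ us.length := by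
  induction us with
  | nil => simp
  | cons u us ih =>
    rw [List.map_cons, List.prod_cons, det_mul, det_reflectionMatrix (hus u (by simp)),
      ih fun v hv => hus v (by simp [hv]), List.length_cons, pow_succ]
    ring

-- Each reflection contributes `-χ(β(u,u)) = -χ(2) χ(β(u,u)/2)`; the powers of `-χ(2)` come from the
-- factor `1/2` in the spinor norm.
open Classical in
lemma sign_prod_reflectionPerm [Fintype F] (h2 : (2 : F) ≠ 0) {B : Matrix n n F}
    (hB : B.IsSymm) {us : List (n → F)} (hus : ∀ u ∈ us, formVal B u u ≠ 0) :
    ((Equiv.Perm.sign (us.map (reflectionPerm hB)).prod : ℤˣ) : ℤ) =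
      (-quadraticChar F 2) ^ us.length *
        quadraticChar F (us.map fun u => formVal B u u / 2).prod := by
  induction us with
  | nil => simp
  | cons u us ih =>
    have hu := hus u (by simp)
    have key : ((Equiv.Perm.sign (reflectionPerm hB u) : ℤˣ) : ℤ) =
        -quadraticChar F 2 * quadraticChar F (formVal B u u / 2) := by
      rw [neg_mul, ← map_mul, mul_div_cancel₀ _ h2, sign_reflectionPerm h2 hB hu]
      split_ifs with h
      · simp [(quadraticChar_one_iff_isSquare hu).2 h]
      · simp [quadraticChar_neg_one_iff_not_isSquare.2 h]
    rw [List.map_cons, List.prod_cons, map_mul, Units.val_mul, key,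
      ih fun v hv => hus v (by simp [hv]), List.map_cons, List.prod_cons, map_mul,
      List.length_cons, pow_succ]
    ring

/-- Two factorizations into reflections of the same matrix give the same square class. -/
theorem exists_prod_formVal_eq_mul_sq [Finite F] (h2 : (2 : F) ≠ 0) {B : Matrix n n F}
    (hB : B.IsSymm) {us vs : List (n → F)} (hus : ∀ u ∈ us, formVal B u u ≠ 0)
    (hvs : ∀ v ∈ vs, formVal B v v ≠ 0)
    (h : (us.map (reflectionMatrix B)).prod = (vs.map (reflectionMatrix B)).prod) :
    ∃ x : F, x ≠ 0 ∧ (vs.map fun v => formVal B v v / 2).prod =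
      (us.map fun u => formVal B u u / 2).prod * x ^ 2 := by
  classical
  have := Fintype.ofFinite F
  have hperm : (us.map (reflectionPerm hB)).prod = (vs.map (reflectionPerm hB)).prod := by
    ext1 v
    exact Subtype.ext (by rw [prod_reflectionPerm_apply, prod_reflectionPerm_apply, h])
  have hpar : (-1 : F) ^ us.length = (-1) ^ vs.length := by
    rw [← det_prod_reflectionMatrix hus, ← det_prod_reflectionMatrix hvs, h]
  have h11 : (-1 : F) ≠ 1 := fun h => h2 (by linear_combination -h)
  have hsq : (-quadraticChar F 2) ^ 2 = 1 := by
    rw [neg_sq, quadraticChar_sq_one h2]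
  -- `-χ(2)` squares to 1, so only the parity of the length matters, and the determinant fixes that
  -- parity since `-1 ≠ 1`.
  have hpow : (-quadraticChar F 2) ^ us.length = (-quadraticChar F 2) ^ vs.length := by
    rcases Nat.even_or_odd us.length with hu | hu <;> rcases Nat.even_or_odd vs.length with hv | hv
    · obtain ⟨a, ha⟩ := hu
      obtain ⟨b, hb⟩ := hv
      rw [ha, hb, ← two_mul, ← two_mul, pow_mul, pow_mul, hsq, one_pow, one_pow]
    · rw [hu.neg_one_pow, hv.neg_one_pow] at hpar
      exact absurd hpar.symm h11
    · rw [hu.neg_one_pow, hv.neg_one_pow] at hpar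
      exact absurd hpar h11
    · obtain ⟨a, ha⟩ := hu
      obtain ⟨b, hb⟩ := hv
      rw [ha, hb, pow_succ, pow_succ, pow_mul, pow_mul, hsq, one_pow, one_pow]
  have hs := sign_prod_reflectionPerm h2 hB hus
  rw [hperm, sign_prod_reflectionPerm h2 hB hvs, hpow] at hs
  have hne : (-quadraticChar F 2) ^ vs.length ≠ 0 :=
    pow_ne_zero _ fun h => by rw [h] at hsq; simp at hsq
  have hs := mul_left_cancel₀ hne hs
  have hu0 := prod_formVal_div_two_ne_zero h2 hus
  have hv0 := prod_formVal_div_two_ne_zero h2 hvs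
  generalize (us.map fun u => formVal B u u / 2).prod = a at *
  generalize (vs.map fun u => formVal B u u / 2).prod = b at *
  have hab : IsSquare (a * b) := by
    rw [← quadraticChar_one_iff_isSquare (mul_ne_zero hu0 hv0), map_mul, hs, ← pow_two,
      quadraticChar_sq_one hu0]
  obtain ⟨c, hc⟩ := hab
  have hc0 : c ≠ 0 := by rintro rfl; simp [hu0, hv0] at hc
  exact ⟨c / a, div_ne_zero hc0 hu0, by field_simp; linear_combination hc⟩

end SphereSign

/-! ### Calculus of spinor classes. -/

section SpinorClass

variable {F : Type*} [Field F] {n : Type*} [Fintype n] [DecidableEq n]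

/-- `g` is a product of reflections in anisotropic vectors, with spinor norm the class of `c`. -/
def HasSpinorClass (B g : Matrix n n F) (c : F) : Prop :=
  ∃ us : List (n → F), (∀ u ∈ us, formVal B u u ≠ 0) ∧
    g = (us.map (reflectionMatrix B)).prod ∧
    ∃ x : F, x ≠ 0 ∧ (us.map fun u => formVal B u u / 2).prod = c * x ^ 2

lemma hasSpinorClass_one (B : Matrix n n F) : HasSpinorClass B 1 1 :=
  ⟨[], by simp, by simp, 1, by simp, by simp⟩

lemma hasSpinorClass_reflectionMatrix {B : Matrix n n F} {u : n → F} (hu : formVal B u u ≠ 0) :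
    HasSpinorClass B (reflectionMatrix B u) (formVal B u u / 2) :=
  ⟨[u], by simpa using hu, by simp, 1, by simp, by simp⟩

lemma HasSpinorClass.mul {B g h : Matrix n n F} {c d : F} (hg : HasSpinorClass B g c)
    (hh : HasSpinorClass B h d) : HasSpinorClass B (g * h) (c * d) := by
  obtain ⟨us, hus, rfl, x, hx, hxc⟩ := hg
  obtain ⟨vs, hvs, rfl, y, hy, hyd⟩ := hh
  refine ⟨us ++ vs, ?_, by simp, x * y, mul_ne_zero hx hy, ?_⟩
  · intro u hu
    exact (List.mem_append.1 hu).elim (hus u) (hvs u)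
  · rw [List.map_append, List.prod_append, hxc, hyd]
    ring

lemma HasSpinorClass.of_eq_mul_sq {B g : Matrix n n F} {c d : F} (hg : HasSpinorClass B g c)
    (x : F) (hx : x ≠ 0) (h : c = d * x ^ 2) : HasSpinorClass B g d := by
  obtain ⟨us, hus, rfl, y, hy, hyc⟩ := hg
  exact ⟨us, hus, rfl, x * y, mul_ne_zero hx hy, by rw [hyc, h]; ring⟩

/-- Reversing a word in reflections inverts it and keeps the product of norms. -/
lemma HasSpinorClass.exists_inv {B g : Matrix n n F} {c : F} (hg : HasSpinorClass B g c) :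
    ∃ h, h * g = 1 ∧ g * h = 1 ∧ HasSpinorClass B h c := by
  obtain ⟨us, hus, rfl, x, hx, hxc⟩ := hg
  have key : ∀ us : List (n → F), ((us.reverse).map (reflectionMatrix B)).prod *
      (us.map (reflectionMatrix B)).prod = 1 := by
    intro us
    induction us with
    | nil => simp
    | cons u us ih =>
      simp only [List.reverse_cons, List.map_append, List.map_cons, List.map_nil, List.prod_append,
        List.prod_cons, List.prod_nil, mul_one]
      rw [mul_assoc, ← mul_assoc (reflectionMatrix B u), reflectionMatrix_mul_self, one_mul, ih]
  refine ⟨(us.reverse.map (reflectionMatrix B)).prod, key us, mul_eq_one_comm.1 (key us),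
    us.reverse, by simpa using hus, rfl, x, hx, ?_⟩
  rw [List.map_reverse, List.prod_reverse, hxc]

/-- Square classes have order two, so `c * d` stands for `d / c`. -/
lemma HasSpinorClass.of_mul_left {B g h : Matrix n n F} {c d : F} (hg : HasSpinorClass B g c)
    (hgh : HasSpinorClass B (g * h) d) : HasSpinorClass B h (c * d) := by
  obtain ⟨g', h1, -, hg'⟩ := hg.exists_inv
  simpa [← mul_assoc, h1] using hg'.mul hgh

lemma HasSpinorClass.of_mul_right {B g h : Matrix n n F} {c d : F} (hg : HasSpinorClass B g c)
    (hhg : HasSpinorClass B (h * g) d) : HasSpinorClass B h (d * c) := by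
  obtain ⟨g', -, h1, hg'⟩ := hg.exists_inv
  simpa [mul_assoc, h1] using hhg.mul hg'

/-- One factorization suffices, since any other gives the same square class. From here on, computing
a spinor norm means exhibiting reflections. -/
lemma HasSpinorClass.spinorNorm_eq [Finite F] (h2 : (2 : F) ≠ 0) {B g : Matrix n n F}
    (hB : B.IsSymm) {c : F} (hg : HasSpinorClass B g c) : spinorNorm B g = sqCoset c := by
  obtain ⟨us, hus, rfl, x, hx, hxc⟩ := hg
  ext y
  constructor
  · rintro ⟨vs, hvs, h, z, hz, rfl⟩
    obtain ⟨w, hw, hwe⟩ := exists_prod_formVal_eq_mul_sq h2 hB hus hvs h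
    exact ⟨x * w * z, by positivity, by rw [hwe, hxc]; ring⟩
  · rintro ⟨z, hz, rfl⟩
    exact ⟨us, hus, rfl, z / x, by positivity, by rw [hxc]; field_simp⟩

end SpinorClass

/-! ### Siegel transformations. -/

section Siegel

variable {F : Type*} [Field F] {n : Type*} [Fintype n] [DecidableEq n]

/-- The Siegel transformation `x ↦ x + β(f,x) v - β(v,x) f - (β(v,v)/2) β(f,x) f`. -/
def siegelMatrix (B : Matrix n n F) (f v : n → F) : Matrix n n F :=
  1 + vecMulVec v (f ᵥ* B) - vecMulVec f (v ᵥ* B) -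
    (formVal B v v / 2) • vecMulVec f (f ᵥ* B)

lemma siegelMatrix_mulVec (B : Matrix n n F) (f v x : n → F) :
    siegelMatrix B f v *ᵥ x = x + formVal B f x • v - formVal B v x • f -
      (formVal B v v / 2 * formVal B f x) • f := by
  simp only [siegelMatrix, sub_mulVec, add_mulVec, one_mulVec, smul_mulVec, vecMulVec_mulVec,
    ← dotProduct_mulVec, op_smul_eq_smul, smul_smul]
  rfl

lemma siegelMatrix_zero (B : Matrix n n F) (f : n → F) : siegelMatrix B f 0 = 1 :=
  mulVec_ext fun x => by simp [siegelMatrix_mulVec, formVal_zero_left]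

/-- The cross term `β(v,w)` arising in the composition is the one that polarizes `β(v+w,v+w)/2`; `v`
and `w` need not be orthogonal. -/
lemma siegelMatrix_mul (h2 : (2 : F) ≠ 0) {B : Matrix n n F} (hB : B.IsSymm) {f v w : n → F}
    (hf : formVal B f f = 0) (hv : formVal B f v = 0) (hw : formVal B f w = 0) :
    siegelMatrix B f v * siegelMatrix B f w = siegelMatrix B f (v + w) :=
  mulVec_ext fun x => by
    rw [← mulVec_mulVec]
    simp only [siegelMatrix_mulVec, formVal_add_left, formVal_add_right, formVal_sub_right,
      formVal_smul_right, hf, hv, hw, formVal_comm hB v f, formVal_comm hB w v]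
    match_scalars <;> field_simp <;> ring

lemma formVal_siegelMatrix (h2 : (2 : F) ≠ 0) {B : Matrix n n F} (hB : B.IsSymm) {f v : n → F}
    (hf : formVal B f f = 0) (hv : formVal B f v = 0) (x y : n → F) :
    formVal B (siegelMatrix B f v *ᵥ x) (siegelMatrix B f v *ᵥ y) = formVal B x y := by
  simp only [siegelMatrix_mulVec, formVal_add_left, formVal_add_right, formVal_sub_right,
    formVal_sub_left, formVal_smul_left, formVal_smul_right, hf, hv, formVal_comm hB v f,
    formVal_comm hB x f, formVal_comm hB x v]
  field_simp
  ring

/-- Both mirror vectors have norm `β(v,v)`, as `f` is isotropic and orthogonal to `v`; the spinor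
class is therefore a square. -/
lemma siegelMatrix_eq_mul_reflectionMatrix (h2 : (2 : F) ≠ 0) {B : Matrix n n F} (hB : B.IsSymm)
    {f v : n → F} (hf : formVal B f f = 0) (hfv : formVal B f v = 0) (hv : formVal B v v ≠ 0) :
    siegelMatrix B f v =
      reflectionMatrix B v * reflectionMatrix B (v + (formVal B v v / 2) • f) :=
  mulVec_ext fun x => by
    rw [← mulVec_mulVec]
    simp only [siegelMatrix_mulVec, reflectionMatrix_mulVec, formVal_add_left, formVal_add_right,
      formVal_sub_right, formVal_smul_left, formVal_smul_right, hf, hfv, formVal_comm hB v f,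
      mul_zero, add_zero]
    match_scalars <;> field_simp <;> ring

lemma hasSpinorClass_siegelMatrix_of_ne_zero (h2 : (2 : F) ≠ 0) {B : Matrix n n F}
    (hB : B.IsSymm) {f v : n → F} (hf : formVal B f f = 0) (hfv : formVal B f v = 0)
    (hv : formVal B v v ≠ 0) : HasSpinorClass B (siegelMatrix B f v) 1 := by
  have hw : formVal B (v + (formVal B v v / 2) • f) (v + (formVal B v v / 2) • f) =
      formVal B v v := by
    simp only [formVal_add_left, formVal_add_right, formVal_smul_left, formVal_smul_right, hf, hfv,
      formVal_comm hB v f]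
    ring
  rw [siegelMatrix_eq_mul_reflectionMatrix h2 hB hf hfv hv]
  refine ((hasSpinorClass_reflectionMatrix hv).mul
    (hasSpinorClass_reflectionMatrix (by rwa [hw]))).of_eq_mul_sq
      (formVal B v v / 2) (div_ne_zero hv h2) ?_
  rw [hw]
  ring

/-- An isotropic `v` is the sum of the anisotropic vectors `v + e` and `-e`, so additivity reduces
this to the anisotropic case. -/
lemma hasSpinorClass_siegelMatrix_of_eq_zero (h2 : (2 : F) ≠ 0) {B : Matrix n n F}
    (hB : B.IsSymm) {f v e : n → F} (hf : formVal B f f = 0) (hfv : formVal B f v = 0)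
    (hv : formVal B v v = 0) (he : formVal B e e ≠ 0) (hfe : formVal B f e = 0)
    (hve : formVal B v e = 0) : HasSpinorClass B (siegelMatrix B f v) 1 := by
  have hfe' : formVal B f (-e) = 0 := by rw [formVal_neg_right, hfe, neg_zero]
  have h : siegelMatrix B f v = siegelMatrix B f (v + e) * siegelMatrix B f (-e) := by
    rw [siegelMatrix_mul h2 hB hf _ hfe', add_neg_cancel_right]
    rw [formVal_add_right, hfv, hfe, add_zero]
  rw [h]
  have h1 : HasSpinorClass B (siegelMatrix B f (v + e)) 1 :=
    hasSpinorClass_siegelMatrix_of_ne_zero h2 hB hf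
      (by rw [formVal_add_right, hfv, hfe, add_zero])
      (by simpa [formVal_add_right, formVal_add_left, hv, hve, formVal_comm hB e v] using he)
  have h3 : HasSpinorClass B (siegelMatrix B f (-e)) 1 :=
    hasSpinorClass_siegelMatrix_of_ne_zero h2 hB hf hfe'
      (by simpa [formVal_neg_left, formVal_neg_right] using he)
  simpa using h1.mul h3

end Siegel

/-! ### The form in the standard basis. -/

section TwistedBasis

variable {F : Type*} [Field F] {m : ℕ}

/-- The index `-a` for a hyperbolic index `a`; the indices `1` and `-1` are fixed. -/
def dualIdx : TwIdx m → TwIdx m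
  | Sum.inl a => Sum.inl a
  | Sum.inr (Sum.inl i) => Sum.inr (Sum.inr i)
  | Sum.inr (Sum.inr i) => Sum.inr (Sum.inl i)

/-- The nonzero entry in row `a` of the matrix of the form. -/
def formWeight (ε : F) : TwIdx m → F
  | Sum.inl a => if a = 0 then 1 else ε
  | Sum.inr _ => 1

@[simp] lemma dualIdx_dualIdx (a : TwIdx m) : dualIdx (dualIdx a) = a := by
  rcases a with a | i | i <;> rfl

lemma formWeight_dualIdx (ε : F) (a : TwIdx m) : formWeight ε (dualIdx a) = formWeight ε a := by
  rcases a with a | i | i <;> rfl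

@[simp] lemma formWeight_inr (ε : F) (p : Fin m ⊕ Fin m) : formWeight ε (Sum.inr p) = 1 := rfl

lemma dualIdx_inr_ne (p : Fin m ⊕ Fin m) : dualIdx (Sum.inr p : TwIdx m) ≠ Sum.inr p := by
  rcases p with i | i <;> simp [dualIdx]

lemma dualIdx_eq_iff {a b : TwIdx m} : dualIdx a = b ↔ a = dualIdx b :=
  ⟨fun h => by rw [← h, dualIdx_dualIdx], fun h => by rw [h, dualIdx_dualIdx]⟩

lemma formWeight_ne_zero {ε : F} (hε : ε ≠ 0) (a : TwIdx m) : formWeight ε a ≠ 0 := by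
  rcases a with a | p
  · simp only [formWeight]
    split_ifs <;> simp [hε]
  · simp

lemma twistedForm_isSymm (ε : F) (m : ℕ) : (twistedForm ε m).IsSymm := by
  rw [twistedForm, IsSymm, fromBlocks_transpose, fromBlocks_transpose]
  congr 1
  · ext i j
    fin_cases i <;> fin_cases j <;> rfl
  · simp

lemma twistedForm_mulVec (ε : F) (x : TwIdx m → F) :
    twistedForm ε m *ᵥ x = fun a => formWeight ε a * x (dualIdx a) := by
  ext a
  rcases a with a | i | i
  · fin_cases a <;>
    simp [twistedForm, mulVec, dotProduct, Fintype.sum_sum_type, dualIdx, formWeight]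
  · simp [twistedForm, mulVec, dotProduct, Fintype.sum_sum_type, dualIdx, one_apply]
  · simp [twistedForm, mulVec, dotProduct, Fintype.sum_sum_type, dualIdx, one_apply]

lemma formVal_single_left (ε : F) (a : TwIdx m) (x : TwIdx m → F) :
    formVal (twistedForm ε m) (Pi.single a 1) x = formWeight ε a * x (dualIdx a) := by
  rw [formVal, twistedForm_mulVec, single_one_dotProduct]

lemma formVal_single_single (ε : F) (a b : TwIdx m) :
    formVal (twistedForm ε m) (Pi.single a 1) (Pi.single b 1) =
      if dualIdx a = b then formWeight ε a else 0 := by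
  rw [formVal_single_left, Pi.single_apply]
  simp

lemma formVal_single_right (ε : F) (a : TwIdx m) (x : TwIdx m → F) :
    formVal (twistedForm ε m) x (Pi.single a 1) = formWeight ε a * x (dualIdx a) := by
  rw [formVal_comm (twistedForm_isSymm ε m), formVal_single_left]

lemma formVal_single_inr_self (ε : F) (p : Fin m ⊕ Fin m) :
    formVal (twistedForm ε m) (Pi.single (Sum.inr p) 1) (Pi.single (Sum.inr p) 1) = 0 := by
  rw [formVal_single_single, if_neg (dualIdx_inr_ne p)]

lemma single_vecMul_twistedForm (ε : F) (a : TwIdx m) :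
    Pi.single a 1 ᵥ* twistedForm ε m = formWeight ε a • Pi.single (dualIdx a) 1 := by
  rw [← mulVec_transpose, (twistedForm_isSymm ε m).eq, twistedForm_mulVec]
  ext b
  simp only [Pi.smul_apply, Pi.single_apply, smul_eq_mul, dualIdx_eq_iff]
  split_ifs with h
  · subst h
    rw [formWeight_dualIdx]
  · simp

end TwistedBasis

/-! ### Elementary matrices as Siegel transformations and reflections. -/

section Elementary

variable {F : Type*} [Field F] {m : ℕ}

lemma siegelMatrix_single (ε : F) (p : Fin m ⊕ Fin m) (k : TwIdx m) (r : F) :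
    siegelMatrix (twistedForm ε m) (Pi.single (Sum.inr p) 1) (r • Pi.single k 1) =
      1 + r • (matUnit k (dualIdx (Sum.inr p)) - formWeight ε k • matUnit (Sum.inr p) (dualIdx k))
        - (r ^ 2 * (if dualIdx k = k then formWeight ε k else 0) / 2) •
          matUnit (Sum.inr p) (dualIdx (Sum.inr p)) := by
  rw [siegelMatrix, formVal_smul_left, formVal_smul_right, formVal_single_single, smul_vecMul,
    single_vecMul_twistedForm, single_vecMul_twistedForm, formWeight_inr, one_smul, matUnit,
    matUnit, matUnit, single_eq_single_vecMulVec_single, single_eq_single_vecMulVec_single,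
    single_eq_single_vecMulVec_single]
  simp only [vecMulVec_smul, smul_vecMulVec]
  match_scalars <;> ring

lemma isElementary_siegelMatrix (ε : F) (p : Fin m ⊕ Fin m) (k : TwIdx m) (hk : k ≠ Sum.inr p)
    (hk' : k ≠ dualIdx (Sum.inr p)) (r : F) :
    IsElementary ε
      (siegelMatrix (twistedForm ε m) (Pi.single (Sum.inr p) 1) (r • Pi.single k 1)) := by
  rw [siegelMatrix_single]
  rcases k with a | j | j <;> rcases p with i | i
  · fin_cases a
    · convert IsElementary.one_pos (ε := ε) i (-r) using 1
      simp only [dualIdx, formWeight, Fin.zero_eta, if_true]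
      match_scalars <;> ring
    · convert IsElementary.negOne_pos (ε := ε) i (-r) using 1
      simp only [dualIdx, formWeight, Fin.mk_one, if_true, one_ne_zero, if_false]
      match_scalars <;> ring
  · fin_cases a
    · convert IsElementary.pos_one (ε := ε) i r using 1
      simp only [dualIdx, formWeight, Fin.zero_eta, if_true]
      match_scalars <;> ring
    · convert IsElementary.pos_negOne (ε := ε) i r using 1
      simp only [dualIdx, formWeight, Fin.mk_one, if_true, one_ne_zero, if_false]
      match_scalars <;> ring
  · have hij : j ≠ i := by simpa using hk
    -- The family is listed only for ordered indices; exchanging the two indices changes the sign of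
    -- the parameter.
    rcases lt_or_gt_of_ne hij with h | h
    · convert IsElementary.pos_neg (ε := ε) j i h r using 1
      simp [dualIdx]
    · convert IsElementary.pos_neg (ε := ε) i j h (-r) using 1
      simp [dualIdx]
      match_scalars <;> ring
  · have hij : j ≠ i := by simpa [dualIdx] using hk'
    convert IsElementary.pos_pos (ε := ε) j i hij r using 1
    simp [dualIdx]
  · have hij : i ≠ j := by simpa [dualIdx, eq_comm] using hk'
    convert IsElementary.pos_pos (ε := ε) i j hij (-r) using 1
    simp [dualIdx]
    match_scalars <;> ring
  · have hij : j ≠ i := by simpa using hk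
    rcases lt_or_gt_of_ne hij with h | h
    · convert IsElementary.neg_pos (ε := ε) j i h r using 1
      simp [dualIdx]
    · convert IsElementary.neg_pos (ε := ε) i j h (-r) using 1
      simp [dualIdx]
      match_scalars <;> ring

lemma IsElementary.exists_eq_siegelMatrix {ε : F} {x : Matrix (TwIdx m) (TwIdx m) F}
    (hx : IsElementary ε x) : ∃ (p : Fin m ⊕ Fin m) (k : TwIdx m) (r : F), k ≠ Sum.inr p ∧
      k ≠ dualIdx (Sum.inr p) ∧
      x = siegelMatrix (twistedForm ε m) (Pi.single (Sum.inr p) 1) (r • Pi.single k 1) := by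
  rcases hx with ⟨i, j, hij, t⟩ | ⟨i, j, hij, t⟩ | ⟨i, j, hij, t⟩ | ⟨i, t⟩ | ⟨i, t⟩ |
    ⟨i, t⟩ | ⟨i, t⟩
  · exact ⟨Sum.inr j, idxPos i, t, by simp, by simpa [dualIdx] using hij, by
      rw [siegelMatrix_single]; simp [dualIdx]⟩
  · exact ⟨Sum.inl j, idxPos i, t, by simpa using hij.ne, by simp [dualIdx], by
      rw [siegelMatrix_single]; simp [dualIdx]⟩
  · exact ⟨Sum.inr j, idxNeg i, t, by simpa using hij.ne, by simp [dualIdx], by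
      rw [siegelMatrix_single]; simp [dualIdx]⟩
  · refine ⟨Sum.inr i, idxOne m, t, by simp, by simp [dualIdx], ?_⟩
    rw [siegelMatrix_single]
    simp [dualIdx, formWeight]
  · refine ⟨Sum.inl i, idxOne m, -t, by simp, by simp [dualIdx], ?_⟩
    rw [siegelMatrix_single]
    simp only [dualIdx, formWeight, if_true]
    match_scalars <;> ring
  · refine ⟨Sum.inr i, idxNegOne m, t, by simp, by simp [dualIdx], ?_⟩
    rw [siegelMatrix_single]
    simp only [dualIdx, formWeight, if_true, one_ne_zero, if_false]
    match_scalars <;> ring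
  · refine ⟨Sum.inl i, idxNegOne m, -t, by simp, by simp [dualIdx], ?_⟩
    rw [siegelMatrix_single]
    simp only [dualIdx, formWeight, if_true, one_ne_zero, if_false]
    match_scalars <;> ring

lemma formVal_single_inr_smul_single (ε : F) {p : Fin m ⊕ Fin m} {k : TwIdx m}
    (hk : k ≠ dualIdx (Sum.inr p)) (r : F) :
    formVal (twistedForm ε m) (Pi.single (Sum.inr p) 1) (r • Pi.single k 1) = 0 := by
  rw [formVal_smul_right, formVal_single_single, if_neg hk.symm, mul_zero]

lemma IsElementary.formVal_mulVec (h2 : (2 : F) ≠ 0) {ε : F} {x : Matrix (TwIdx m) (TwIdx m) F}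
    (hx : IsElementary ε x) (u v : TwIdx m → F) :
    formVal (twistedForm ε m) (x *ᵥ u) (x *ᵥ v) = formVal (twistedForm ε m) u v := by
  obtain ⟨p, k, r, -, hk, rfl⟩ := hx.exists_eq_siegelMatrix
  exact formVal_siegelMatrix h2 (twistedForm_isSymm ε m) (formVal_single_inr_self ε p)
    (formVal_single_inr_smul_single ε hk r) u v

/-- For `k = ±1` the vector `e_k` is anisotropic. For hyperbolic `k` it is isotropic, and `e_1` is
the auxiliary anisotropic vector. -/
lemma hasSpinorClass_siegelMatrix_single (h2 : (2 : F) ≠ 0) {ε : F} (hε : ε ≠ 0)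
    {p : Fin m ⊕ Fin m} {k : TwIdx m} (hk : k ≠ dualIdx (Sum.inr p)) (r : F) :
    HasSpinorClass (twistedForm ε m)
      (siegelMatrix (twistedForm ε m) (Pi.single (Sum.inr p) 1) (r • Pi.single k 1)) 1 := by
  have hf := formVal_single_inr_self ε p
  have hfv := formVal_single_inr_smul_single ε hk r
  rcases k with a | q
  · by_cases hr : r = 0
    · rw [hr, zero_smul, siegelMatrix_zero]
      exact hasSpinorClass_one _
    · refine hasSpinorClass_siegelMatrix_of_ne_zero h2 (twistedForm_isSymm ε m) hf hfv ?_
      rw [formVal_smul_left, formVal_smul_right, formVal_single_single, if_pos (by rfl)]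
      exact mul_ne_zero hr (mul_ne_zero hr (formWeight_ne_zero hε _))
  · refine hasSpinorClass_siegelMatrix_of_eq_zero (e := Pi.single (idxOne m) 1) h2
      (twistedForm_isSymm ε m) hf hfv ?_ ?_ ?_ ?_
    · rw [formVal_smul_left, formVal_smul_right, formVal_single_inr_self, mul_zero, mul_zero]
    · rw [formVal_single_single, if_pos (by rfl)]
      exact formWeight_ne_zero hε _
    · rw [formVal_single_right]
      simp [dualIdx]
    · rw [formVal_smul_left, formVal_single_right]
      simp [dualIdx]

lemma IsElementary.hasSpinorClass (h2 : (2 : F) ≠ 0) {ε : F} (hε : ε ≠ 0)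
    {x : Matrix (TwIdx m) (TwIdx m) F} (hx : IsElementary ε x) :
    HasSpinorClass (twistedForm ε m) x 1 := by
  obtain ⟨p, k, r, -, hk, rfl⟩ := hx.exists_eq_siegelMatrix
  exact hasSpinorClass_siegelMatrix_single h2 hε hk r

lemma IsElementary.det_eq_one (h2 : (2 : F) ≠ 0) {ε : F} (hε : ε ≠ 0)
    {x : Matrix (TwIdx m) (TwIdx m) F} (hx : IsElementary ε x) : x.det = 1 := by
  obtain ⟨p, k, r, -, hk, rfl⟩ := hx.exists_eq_siegelMatrix
  -- Halving the parameter writes the matrix as a square of a product of reflections, whose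
  -- determinant is `((-1)^n)² = 1`.
  have hr : r • (Pi.single k 1 : TwIdx m → F) =
      (r / 2) • Pi.single k 1 + (r / 2) • Pi.single k 1 := by
    have := NeZero.mk h2
    rw [← add_smul, add_halves]
  have h0 := formVal_single_inr_smul_single ε hk (r / 2)
  rw [hr, ← siegelMatrix_mul h2 (twistedForm_isSymm ε m) (formVal_single_inr_self ε p) h0 h0,
    det_mul]
  obtain ⟨us, hus, h, -⟩ := hasSpinorClass_siegelMatrix_single h2 hε hk (r / 2)
  rw [h, det_prod_reflectionMatrix hus, ← mul_pow]
  simp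

lemma formVal_hyperbolic (ε : F) (i : Fin m) (c : F) (x : TwIdx m → F) :
    formVal (twistedForm ε m) (Pi.single (idxPos i) 1 + c • Pi.single (idxNeg i) 1) x =
      x (idxNeg i) + c * x (idxPos i) := by
  rw [formVal_add_left, formVal_smul_left, formVal_single_left, formVal_single_left]
  simp [dualIdx]

lemma formVal_hyperbolic_self (ε : F) (i : Fin m) (c : F) :
    formVal (twistedForm ε m) (Pi.single (idxPos i) 1 + c • Pi.single (idxNeg i) 1)
      (Pi.single (idxPos i) 1 + c • Pi.single (idxNeg i) 1) = 2 * c := by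
  rw [formVal_hyperbolic]
  simp
  ring

lemma elemW_eq_reflectionMatrix (h2 : (2 : F) ≠ 0) (ε : F) (i : Fin m) :
    elemW i = reflectionMatrix (twistedForm ε m)
      (Pi.single (idxPos i) 1 + (1 : F) • Pi.single (idxNeg i) 1) := by
  rw [reflectionMatrix, formVal_hyperbolic_self, mul_one, div_self h2, one_smul, one_smul,
    add_vecMul, single_vecMul_twistedForm, single_vecMul_twistedForm, elemW]
  simp only [single_eq_single_vecMulVec_single, vecMulVec_add, add_vecMulVec, formWeight_inr,
    one_smul, dualIdx]
  abel

lemma hasSpinorClass_elemW (h2 : (2 : F) ≠ 0) (ε : F) (i : Fin m) :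
    HasSpinorClass (twistedForm ε m) (elemW i) 1 := by
  have h := formVal_hyperbolic_self ε i 1
  rw [elemW_eq_reflectionMatrix h2 ε]
  convert hasSpinorClass_reflectionMatrix (by rw [h]; simpa using h2) using 1
  rw [h, mul_one, div_self h2]

lemma det_elemW (h2 : (2 : F) ≠ 0) (i : Fin m) : (elemW i : Matrix _ _ F).det = -1 := by
  -- `w_i` does not involve `ε`, so any value, here `1`, serves.
  rw [elemW_eq_reflectionMatrix h2 1]
  exact det_reflectionMatrix (by rw [formVal_hyperbolic_self]; simpa using h2)

lemma formVal_elemW_mulVec (h2 : (2 : F) ≠ 0) (ε : F) (i : Fin m) (u v : TwIdx m → F) :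
    formVal (twistedForm ε m) (elemW i *ᵥ u) (elemW i *ᵥ v) = formVal (twistedForm ε m) u v := by
  rw [elemW_eq_reflectionMatrix h2 ε, formVal_reflectionMatrix (twistedForm_isSymm ε m)]

end Elementary

/-! ### Invariants of the elimination steps. -/

section Reduces

variable {F : Type*} [Field F] {m : ℕ} {ε : F} {g h : Matrix (TwIdx m) (TwIdx m) F} {N : ℕ}

lemma Reduces.det_eq (h2 : (2 : F) ≠ 0) (hε : ε ≠ 0) (hr : Reduces ε g N h) :
    h.det = (-1) ^ N * g.det := by
  induction hr with
  | refl => simp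
  | row _ hx ih => rw [det_mul, hx.det_eq_one h2 hε, one_mul, ih]
  | col _ hx ih => rw [det_mul, hx.det_eq_one h2 hε, mul_one, ih]
  | rowW _ i ih => rw [det_mul, det_elemW h2, ih]; ring
  | colW _ i ih => rw [det_mul, det_elemW h2, ih]; ring

lemma Reduces.hasSpinorClass (h2 : (2 : F) ≠ 0) (hε : ε ≠ 0) (hr : Reduces ε g N h) {c : F}
    (hh : HasSpinorClass (twistedForm ε m) h c) : HasSpinorClass (twistedForm ε m) g c := by
  induction hr with
  | refl => exact hh
  | row _ hx ih => exact ih (by simpa using (hx.hasSpinorClass h2 hε).of_mul_left hh)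
  | col _ hx ih => exact ih (by simpa using (hx.hasSpinorClass h2 hε).of_mul_right hh)
  | rowW _ i ih => exact ih (by simpa using (hasSpinorClass_elemW h2 ε i).of_mul_left hh)
  | colW _ i ih => exact ih (by simpa using (hasSpinorClass_elemW h2 ε i).of_mul_right hh)

lemma Reduces.formVal_mulVec (h2 : (2 : F) ≠ 0) (hr : Reduces ε g N h)
    (hg : ∀ u v, formVal (twistedForm ε m) (g *ᵥ u) (g *ᵥ v) = formVal (twistedForm ε m) u v)
    (u v : TwIdx m → F) :
    formVal (twistedForm ε m) (h *ᵥ u) (h *ᵥ v) = formVal (twistedForm ε m) u v := by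
  induction hr generalizing u v with
  | refl => exact hg u v
  | row _ hx ih => rw [← mulVec_mulVec, ← mulVec_mulVec, hx.formVal_mulVec h2, ih]
  | col _ hx ih => rw [← mulVec_mulVec, ← mulVec_mulVec, ih, hx.formVal_mulVec h2]
  | rowW _ i ih => rw [← mulVec_mulVec, ← mulVec_mulVec, formVal_elemW_mulVec h2, ih]
  | colW _ i ih => rw [← mulVec_mulVec, ← mulVec_mulVec, ih, formVal_elemW_mulVec h2]

end Reduces

/-! ### Existence of an output. -/

section Elimination

variable {F : Type*} [Field F] {m : ℕ}

/-- The products of elementary matrices that fix `e_i` and `e₋ᵢ` for the first `k` hyperbolic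
pairs. -/
def elemSubmonoid (ε : F) (m k : ℕ) : Submonoid (Matrix (TwIdx m) (TwIdx m) F) where
  carrier := {a | a ∈ Submonoid.closure {x | IsElementary ε x} ∧
    ∀ i : Fin m, (i : ℕ) < k → a *ᵥ Pi.single (idxPos i) 1 = Pi.single (idxPos i) 1 ∧
      a *ᵥ Pi.single (idxNeg i) 1 = Pi.single (idxNeg i) 1}
  one_mem' := ⟨one_mem _, fun i _ => by simp only [one_mulVec, and_self]⟩
  mul_mem' := by
    rintro a b ⟨ha, ha'⟩ ⟨hb, hb'⟩
    refine ⟨mul_mem ha hb, fun i hi => ?_⟩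
    rw [← mulVec_mulVec, ← mulVec_mulVec, (hb' i hi).1, (hb' i hi).2]
    exact ha' i hi

lemma formVal_mulVec_of_mem_closure (h2 : (2 : F) ≠ 0) {ε : F}
    {a : Matrix (TwIdx m) (TwIdx m) F} (ha : a ∈ Submonoid.closure {x | IsElementary ε x})
    (u v : TwIdx m → F) :
    formVal (twistedForm ε m) (a *ᵥ u) (a *ᵥ v) = formVal (twistedForm ε m) u v := by
  induction ha using Submonoid.closure_induction generalizing u v with
  | mem x hx => exact IsElementary.formVal_mulVec h2 hx u v
  | one => simp
  | mul x y _ _ hx hy => rw [← mulVec_mulVec, ← mulVec_mulVec, hx, hy]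

lemma Reduces.mul_left {ε : F} {a g h : Matrix (TwIdx m) (TwIdx m) F} {N : ℕ}
    (ha : a ∈ Submonoid.closure {x | IsElementary ε x}) (hr : Reduces ε g N h) :
    Reduces ε g N (a * h) := by
  induction ha using Submonoid.closure_induction generalizing h with
  | mem x hx => exact .row hr hx
  | one => simpa using hr
  | mul x y _ _ hx hy => rw [mul_assoc]; exact hx (hy hr)

/-- The vector `v` has no component along the first `k` hyperbolic pairs. -/
def VanishesBelow (k : ℕ) (v : TwIdx m → F) : Prop :=
  ∀ i : Fin m, (i : ℕ) < k → v (idxPos i) = 0 ∧ v (idxNeg i) = 0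

/-- Additivity in `v` splits the transformation into one elementary factor for each coordinate of
`v`. -/
lemma siegelMatrix_mem_closure (h2 : (2 : F) ≠ 0) (ε : F) (p : Fin m ⊕ Fin m)
    {v : TwIdx m → F} (hp : v (Sum.inr p) = 0) (hp' : v (dualIdx (Sum.inr p)) = 0) :
    siegelMatrix (twistedForm ε m) (Pi.single (Sum.inr p) 1) v ∈
      Submonoid.closure {x | IsElementary ε x} := by
  have key : ∀ s : Finset (TwIdx m), Sum.inr p ∉ s → dualIdx (Sum.inr p) ∉ s →
      siegelMatrix (twistedForm ε m) (Pi.single (Sum.inr p) 1) (∑ k ∈ s, v k • Pi.single k 1) ∈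
        Submonoid.closure {x | IsElementary ε x} := by
    intro s
    induction s using Finset.induction_on with
    | empty => intro _ _; simp [siegelMatrix_zero]
    | insert k s hks ih =>
      intro h1 h3
      simp only [Finset.mem_insert, not_or] at h1 h3
      rw [Finset.sum_insert hks, ← siegelMatrix_mul h2 (twistedForm_isSymm ε m)
        (formVal_single_inr_self ε p) (formVal_single_inr_smul_single ε (Ne.symm h3.1) _)]
      · exact mul_mem (Submonoid.subset_closure
          (isElementary_siegelMatrix ε p k (Ne.symm h1.1) (Ne.symm h3.1) _)) (ih h1.2 h3.2)
      · rw [formVal_single_left, Finset.sum_apply, Finset.sum_eq_zero, mul_zero]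
        intro x hx
        rw [Pi.smul_apply, Pi.single_apply, if_neg, smul_zero]
        rintro rfl
        exact h3.2 hx
  have hv : v = ∑ k ∈ (Finset.univ.erase (Sum.inr p)).erase (dualIdx (Sum.inr p)),
      v k • Pi.single k 1 := by
    rw [Finset.sum_erase _ (by simp [hp']), Finset.sum_erase _ (by simp [hp])]
    ext j
    simp [Finset.sum_apply, Pi.single_apply]
  rw [hv]
  exact key _ (by simp) (by simp)

lemma siegelMatrix_single_mulVec (ε : F) (p : Fin m ⊕ Fin m) (v x : TwIdx m → F) :
    siegelMatrix (twistedForm ε m) (Pi.single (Sum.inr p) 1) v *ᵥ x =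
      x + x (dualIdx (Sum.inr p)) • v - (formVal (twistedForm ε m) v x +
        formVal (twistedForm ε m) v v / 2 * x (dualIdx (Sum.inr p))) • Pi.single (Sum.inr p) 1 := by
  rw [siegelMatrix_mulVec, formVal_single_left, formWeight_inr, one_mul]
  module

lemma siegelMatrix_mem_elemSubmonoid (h2 : (2 : F) ≠ 0) (ε : F) {k : ℕ} (p : Fin m ⊕ Fin m)
    (hpk : k ≤ (Sum.elim id id p : Fin m)) {v : TwIdx m → F} (hv : VanishesBelow k v)
    (hp : v (Sum.inr p) = 0) (hp' : v (dualIdx (Sum.inr p)) = 0) :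
    siegelMatrix (twistedForm ε m) (Pi.single (Sum.inr p) 1) v ∈ elemSubmonoid ε m k := by
  refine ⟨siegelMatrix_mem_closure h2 ε p hp hp', fun i hi => ?_⟩
  have hip : ∀ b, Sum.elim id id b = i → dualIdx (Sum.inr p) ≠ Sum.inr b := by
    rintro (b | b) rfl h <;> rcases p with p | p <;> simp [dualIdx] at h
    · subst h; simp at hi hpk; lia
    · subst h; simp at hi hpk; lia
  rw [siegelMatrix_single_mulVec, siegelMatrix_single_mulVec, formVal_single_right,
    formVal_single_right, Pi.single_eq_of_ne (hip (Sum.inl i) rfl),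
    Pi.single_eq_of_ne (hip (Sum.inr i) rfl)]
  simp [dualIdx, (hv i hi).1, (hv i hi).2]

/-- Coordinates are pairings with basis vectors, and `a` is an isometry fixing the relevant ones. -/
lemma VanishesBelow.mulVec (h2 : (2 : F) ≠ 0) {ε : F} {k : ℕ} {x : TwIdx m → F}
    (hx : VanishesBelow k x) {a : Matrix (TwIdx m) (TwIdx m) F} (ha : a ∈ elemSubmonoid ε m k) :
    VanishesBelow k (a *ᵥ x) := by
  intro i hi
  obtain ⟨h1, h3⟩ := ha.2 i hi
  have e1 := formVal_mulVec_of_mem_closure h2 ha.1 (Pi.single (idxPos i) 1) x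
  have e2 := formVal_mulVec_of_mem_closure h2 ha.1 (Pi.single (idxNeg i) 1) x
  rw [h1, formVal_single_left, formVal_single_left] at e1
  rw [h3, formVal_single_left, formVal_single_left] at e2
  simp only [dualIdx, formWeight_inr, one_mul] at e1 e2
  rw [e1, e2]
  exact hx i hi

/-- A Siegel transformation along `e_p` clears all coordinates of an isotropic vector except the
one at `-p`, provided the latter is nonzero. -/
lemma exists_mulVec_eq_smul_single (h2 : (2 : F) ≠ 0) (ε : F) {k : ℕ} (p : Fin m ⊕ Fin m)
    (hpk : k ≤ (Sum.elim id id p : Fin m)) {x : TwIdx m → F} (hx : VanishesBelow k x)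
    (hx0 : formVal (twistedForm ε m) x x = 0) (hp : x (dualIdx (Sum.inr p)) ≠ 0) :
    ∃ a ∈ elemSubmonoid ε m k, a *ᵥ Pi.single (Sum.inr p) 1 = Pi.single (Sum.inr p) 1 ∧
      a *ᵥ x = x (dualIdx (Sum.inr p)) • Pi.single (dualIdx (Sum.inr p)) 1 := by
  set q : TwIdx m := dualIdx (Sum.inr p) with hq
  have hqp : q ≠ Sum.inr p := dualIdx_inr_ne p
  -- Away from `p`, the transformation adds `x q • v`, so this `v` cancels every coordinate except
  -- those at `p` and `q`.
  let v : TwIdx m → F := fun j => if j = Sum.inr p ∨ j = q then 0 else -(x q)⁻¹ * x j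
  have hvp : v (Sum.inr p) = 0 := by simp [v]
  have hvq : v q = 0 := by simp [v]
  have hv : VanishesBelow k v := fun i hi => by simp [v, hx i hi]
  have hmem := siegelMatrix_mem_elemSubmonoid h2 ε p hpk hv hvp hvq
  refine ⟨_, hmem, ?_, ?_⟩
  · rw [siegelMatrix_single_mulVec, formVal_single_right, Pi.single_eq_of_ne hqp, ← hq, hvq]
    simp
  · set z := siegelMatrix (twistedForm ε m) (Pi.single (Sum.inr p) 1) v *ᵥ x with hz
    have hzz : formVal (twistedForm ε m) z z = 0 := by
      rw [hz, formVal_mulVec_of_mem_closure h2 hmem.1, hx0]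
    have hzj : ∀ j, j ≠ Sum.inr p → z j = if j = q then x q else 0 := by
      intro j hj
      rw [hz, siegelMatrix_single_mulVec, Pi.sub_apply, Pi.smul_apply, Pi.single_eq_of_ne hj,
        Pi.add_apply, Pi.smul_apply]
      by_cases hjq : j = q
      · subst hjq
        simp [hvq]
      · simp only [smul_eq_mul, v, hj, hjq, or_self, if_false]
        rw [← hq]
        field_simp
        ring
    have hzeq : z = z (Sum.inr p) • Pi.single (Sum.inr p) 1 + x q • Pi.single q 1 := by
      ext j
      by_cases hj : j = Sum.inr p
      · subst hj
        simp [Pi.single_eq_of_ne hqp.symm]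
      · rw [hzj j hj]
        simp [Pi.single_apply, hj]
    -- The remaining coordinate vanishes by isotropy: `0 = β(z,z) = 2 z_p x_q`.
    have hzp : z (Sum.inr p) = 0 := by
      rw [hzeq] at hzz
      simp only [formVal_add_left, formVal_add_right, formVal_smul_left, formVal_smul_right,
        formVal_single_single, ← hq, if_neg hqp, if_true] at hzz
      have hqq : dualIdx q = Sum.inr p := dualIdx_dualIdx _
      rw [hqq, if_neg hqp.symm, if_pos rfl, hq, formWeight_dualIdx, formWeight_inr, ← hq] at hzz
      have : 2 * (z (Sum.inr p) * x q) = 0 := by linear_combination hzz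
      simpa [h2, hp] using this
    rw [hzeq, hzp, zero_smul, zero_add]

lemma VanishesBelow.smul_single {k : ℕ} {a : TwIdx m} (c : F)
    (ha : ∀ i : Fin m, (i : ℕ) < k → a ≠ idxPos i ∧ a ≠ idxNeg i) :
    VanishesBelow k (c • Pi.single a 1 : TwIdx m → F) := fun i hi => by
  simp [Pi.single_eq_of_ne (ha i hi).1.symm, Pi.single_eq_of_ne (ha i hi).2.symm]

lemma exists_mulVec_apply_ne_zero (h2 : (2 : F) ≠ 0) {ε : F} (hε : ε ≠ 0) (k : Fin m)
    {x : TwIdx m → F} (hx : VanishesBelow k x) (hne : x ≠ 0) :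
    ∃ a ∈ elemSubmonoid ε m k, (a *ᵥ x) (idxPos k) ≠ 0 := by
  by_cases hk : x (idxPos k) = 0
  swap
  · exact ⟨1, one_mem _, by simpa using hk⟩
  by_cases hk' : x (idxNeg k) = 0
  · obtain ⟨b, hb⟩ := Function.ne_iff.1 hne
    have hlow : ∀ i : Fin m, (i : ℕ) < k → dualIdx b ≠ idxPos i ∧ dualIdx b ≠ idxNeg i := by
      intro i hi
      rw [ne_eq, ne_eq, dualIdx_eq_iff, dualIdx_eq_iff]
      constructor <;> rintro rfl
      · exact hb (hx i hi).2
      · exact hb (hx i hi).1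
    refine ⟨siegelMatrix (twistedForm ε m) (Pi.single (idxPos k) 1) ((1 : F) • Pi.single (dualIdx b) 1),
      siegelMatrix_mem_elemSubmonoid h2 ε (Sum.inl k) le_rfl (.smul_single 1 hlow) ?_ ?_, ?_⟩
    · rw [Pi.smul_apply, Pi.single_eq_of_ne, smul_zero]
      rw [ne_eq, eq_comm, dualIdx_eq_iff]
      rintro rfl
      exact hb hk'
    · rw [Pi.smul_apply, Pi.single_eq_of_ne, smul_zero]
      intro h
      have h := congrArg dualIdx h
      simp only [dualIdx_dualIdx] at h
      rw [← h] at hb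
      exact hb hk
    · rw [siegelMatrix_single_mulVec, formVal_smul_left, formVal_single_left]
      have hk'' : x (dualIdx (Sum.inr (Sum.inl k))) = 0 := hk'
      simp [hk, hk'', formWeight_ne_zero hε]
      exact hb
  · have hmem : ∀ r : F, siegelMatrix (twistedForm ε m) (Pi.single (idxPos k) 1)
        (r • Pi.single (idxOne m) 1) ∈ elemSubmonoid ε m k := fun r =>
      siegelMatrix_mem_elemSubmonoid h2 ε (Sum.inl k) le_rfl
        (.smul_single r fun i hi => by simp) (by simp) (by simp [dualIdx])
    have hval : ∀ r : F, (siegelMatrix (twistedForm ε m) (Pi.single (idxPos k) 1)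
        (r • Pi.single (idxOne m) 1) *ᵥ x) (idxPos k) =
          -(r * x (idxOne m) + r ^ 2 / 2 * x (idxNeg k)) := by
      intro r
      rw [siegelMatrix_single_mulVec, formVal_smul_left, formVal_single_left, formVal_smul_left,
        formVal_single_left]
      simp [dualIdx, hk, formWeight, -mul_eq_mul_left_iff, -mul_eq_mul_right_iff]
      ring
    -- The values at `r = 1` and `r = -1` add up to `-x_{-k} ≠ 0`, so one of them is nonzero.
    by_cases h1 : (1 : F) * x (idxOne m) + 1 ^ 2 / 2 * x (idxNeg k) = 0
    · refine ⟨_, hmem (-1), ?_⟩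
      rw [hval]
      intro h
      apply hk'
      linear_combination h1 - h - x (idxNeg k) * inv_mul_cancel₀ h2
    · exact ⟨_, hmem 1, by rw [hval]; exact neg_ne_zero.2 h1⟩

/-- Clearing leaves `c e_k`. If a further pair `j` is available, it serves to normalize `c` to 1;
for the last pair `c` remains, and becomes `λ`. -/
lemma exists_mulVec_eq_smul_idxPos (h2 : (2 : F) ≠ 0) {ε : F} (hε : ε ≠ 0) (k : Fin m)
    {x : TwIdx m → F} (hx : VanishesBelow k x) (hx0 : formVal (twistedForm ε m) x x = 0)
    (hne : x ≠ 0) :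
    ∃ a ∈ elemSubmonoid ε m k, ∃ c : F, c ≠ 0 ∧ ((k : ℕ) + 1 < m → c = 1) ∧
      a *ᵥ x = c • Pi.single (idxPos k) 1 := by
  obtain ⟨a, ha, hak⟩ := exists_mulVec_apply_ne_zero h2 hε k hx hne
  obtain ⟨b, hb, -, hbx⟩ := exists_mulVec_eq_smul_single h2 ε (Sum.inr k) le_rfl
    (hx.mulVec h2 ha) (by rw [formVal_mulVec_of_mem_closure h2 ha.1, hx0]) hak
  set c := (a *ᵥ x) (dualIdx (Sum.inr (Sum.inr k))) with hc
  have hc0 : c ≠ 0 := hak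
  by_cases hkm : (k : ℕ) + 1 < m
  swap
  · exact ⟨b * a, mul_mem hb ha, c, hak, fun h => absurd h hkm, by rw [← mulVec_mulVec, hbx]; rfl⟩
  let j : Fin m := ⟨k + 1, hkm⟩
  have hjk : j ≠ k := fun h => by simpa [j] using congrArg Fin.val h
  have hkj : k ≠ j := hjk.symm
  -- The two transformations give `c e_k ↦ c e_k - c e_j ↦ e_k - c e_j`; the parameter `(1 - c)/c`
  -- is chosen to add `1 - c` to the `e_k`-coordinate. A final clearing removes `e_j`.
  have hs : siegelMatrix (twistedForm ε m) (Pi.single (idxPos j) 1)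
      ((1 : F) • Pi.single (idxNeg k) 1) ∈ elemSubmonoid ε m k :=
    siegelMatrix_mem_elemSubmonoid h2 ε (Sum.inl j) (by simp [j])
      (.smul_single 1 fun i hi => by
        have hi : (i : ℕ) < k := hi
        simp [Fin.ext_iff]
        lia) (by simp) (by simp [dualIdx, hjk])
  have ht : siegelMatrix (twistedForm ε m) (Pi.single (idxPos k) 1)
      (((1 - c) / c) • Pi.single (idxNeg j) 1) ∈ elemSubmonoid ε m k :=
    siegelMatrix_mem_elemSubmonoid h2 ε (Sum.inl k) le_rfl
      (.smul_single _ fun i hi => by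
        have hi : (i : ℕ) < k := hi
        simp [j, Fin.ext_iff]
        lia) (by simp) (by simp [dualIdx, hkj])
  have hst := mul_mem ht (mul_mem hs (mul_mem hb ha))
  have hy1 : (siegelMatrix (twistedForm ε m) (Pi.single (idxPos k) 1)
      (((1 - c) / c) • Pi.single (idxNeg j) 1) * (siegelMatrix (twistedForm ε m)
        (Pi.single (idxPos j) 1) ((1 : F) • Pi.single (idxNeg k) 1) * (b * a))) *ᵥ x =
      Pi.single (idxPos k) 1 - c • Pi.single (idxPos j) 1 := by
    rw [← mulVec_mulVec, ← mulVec_mulVec, ← mulVec_mulVec, hbx, siegelMatrix_single_mulVec ε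
      (Sum.inl j), siegelMatrix_single_mulVec ε (Sum.inl k)]
    simp only [formVal_smul_left, formVal_smul_right, formVal_single_left, dualIdx, formWeight_inr]
    ext i
    simp [Pi.single_apply, hjk]
    field_simp
    split_ifs <;> ring1
  have hy0 : formVal (twistedForm ε m) (Pi.single (idxPos k) 1 - c • Pi.single (idxPos j) 1)
      (Pi.single (idxPos k) 1 - c • Pi.single (idxPos j) 1) = 0 := by
    rw [← hy1, formVal_mulVec_of_mem_closure h2 hst.1, hx0]
  have hyk : (Pi.single (idxPos k) 1 - c • Pi.single (idxPos j) 1 : TwIdx m → F)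
      (dualIdx (Sum.inr (Sum.inr k))) = 1 := by
    simp [dualIdx, hkj]
  obtain ⟨d, hd, -, hdx⟩ := exists_mulVec_eq_smul_single h2 ε (Sum.inr k) le_rfl
    (hy1 ▸ hx.mulVec h2 hst) hy0 (by rw [hyk]; exact one_ne_zero)
  refine ⟨_, mul_mem hd hst, 1, one_ne_zero, fun _ => rfl, ?_⟩
  rw [← mulVec_mulVec, hy1, hdx, hyk]
  rfl

/-- The `k`-th hyperbolic pair can be brought to diagonal form. -/
lemma exists_diagonalize_pair (h2 : (2 : F) ≠ 0) {ε : F} (hε : ε ≠ 0) (k : Fin m)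
    {g : Matrix (TwIdx m) (TwIdx m) F}
    (hg : ∀ u v, formVal (twistedForm ε m) (g *ᵥ u) (g *ᵥ v) = formVal (twistedForm ε m) u v)
    (hgk : ∀ i : Fin m, (i : ℕ) < k → g *ᵥ Pi.single (idxPos i) 1 = Pi.single (idxPos i) 1 ∧
      g *ᵥ Pi.single (idxNeg i) 1 = Pi.single (idxNeg i) 1) :
    ∃ a ∈ elemSubmonoid ε m k, ∃ c : F, c ≠ 0 ∧ ((k : ℕ) + 1 < m → c = 1) ∧
      (a * g) *ᵥ Pi.single (idxPos k) 1 = c • Pi.single (idxPos k) 1 ∧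
      (a * g) *ᵥ Pi.single (idxNeg k) 1 = c⁻¹ • Pi.single (idxNeg k) 1 := by
  have hvan : ∀ b : TwIdx m, (∀ i : Fin m, (i : ℕ) < k → b ≠ idxPos i ∧ b ≠ idxNeg i) →
      VanishesBelow k (g *ᵥ Pi.single b 1) := by
    intro b hb i hi
    have e1 := hg (Pi.single (idxPos i) 1) (Pi.single b 1)
    have e2 := hg (Pi.single (idxNeg i) 1) (Pi.single b 1)
    rw [(hgk i hi).1, formVal_single_single, if_neg (show ¬ dualIdx (idxPos i) = b from (hb i hi).2.symm), formVal_single_left] at e1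
    rw [(hgk i hi).2, formVal_single_single, if_neg (show ¬ dualIdx (idxNeg i) = b from (hb i hi).1.symm), formVal_single_left] at e2
    exact ⟨by simpa [dualIdx] using e2, by simpa [dualIdx] using e1⟩
  have hpair := hg (Pi.single (idxPos k) 1) (Pi.single (idxNeg k) 1)
  rw [formVal_single_single, if_pos (by rfl), formWeight_inr] at hpair
  obtain ⟨a, ha, c, hc0, hc1, hac⟩ := exists_mulVec_eq_smul_idxPos h2 hε k
    (hvan (idxPos k) fun i hi => by simp [Fin.ext_iff]; lia)
    (by rw [hg, formVal_single_inr_self])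
    (fun h => by rw [h, formVal_zero_left] at hpair; exact zero_ne_one hpair)
  -- The pairing of the two images is still 1, which forces the coordinate `c⁻¹`. The next
  -- transformation is along `e_k` itself, so it does not disturb the first image.
  have hval : (a *ᵥ (g *ᵥ Pi.single (idxNeg k) 1)) (dualIdx (Sum.inr (Sum.inl k))) = c⁻¹ := by
    rw [← formVal_mulVec_of_mem_closure h2 ha.1, hac, formVal_smul_left, formVal_single_left,
      formWeight_inr, one_mul] at hpair
    exact eq_inv_of_mul_eq_one_right hpair
  obtain ⟨b, hb, hbk, hbx⟩ := exists_mulVec_eq_smul_single h2 ε (Sum.inl k) le_rfl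
    ((hvan (idxNeg k) fun i hi => by simp [Fin.ext_iff]; lia).mulVec h2 ha)
    (by rw [formVal_mulVec_of_mem_closure h2 ha.1, hg, formVal_single_inr_self])
    (by rw [hval]; exact inv_ne_zero hc0)
  refine ⟨b * a, mul_mem hb ha, c, hc0, hc1, ?_, ?_⟩
  · rw [← mulVec_mulVec, ← mulVec_mulVec, hac, mulVec_smul, hbk]
  · rw [← mulVec_mulVec, ← mulVec_mulVec, hbx, hval]
    rfl

/-- Induction over the hyperbolic pairs. The case `k = 0` of the condition on `c` supplies the
convention `λ = 1` when there are no pairs. -/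
lemma exists_elim (h2 : (2 : F) ≠ 0) {ε : F} (hε : ε ≠ 0)
    {g : Matrix (TwIdx m) (TwIdx m) F}
    (hg : ∀ u v, formVal (twistedForm ε m) (g *ᵥ u) (g *ᵥ v) = formVal (twistedForm ε m) u v)
    (k : ℕ) (hk : k ≤ m) :
    ∃ a ∈ Submonoid.closure {x | IsElementary ε x}, ∃ c : F, c ≠ 0 ∧ (k < m ∨ k = 0 → c = 1) ∧
      ∀ i : Fin m, (i : ℕ) < k →
        (a * g) *ᵥ Pi.single (idxPos i) 1 =
          (if (i : ℕ) + 1 = m then c else 1) • Pi.single (idxPos i) 1 ∧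
        (a * g) *ᵥ Pi.single (idxNeg i) 1 =
          (if (i : ℕ) + 1 = m then c⁻¹ else 1) • Pi.single (idxNeg i) 1 := by
  induction k with
  | zero => exact ⟨1, one_mem _, 1, one_ne_zero, fun _ => rfl, by simp⟩
  | succ k ih =>
    -- The earlier scalar can be forgotten: it occurs only at the last index, which lies beyond the
    -- first `k`.
    obtain ⟨a, ha, c, -, -, hac⟩ := ih (by lia)
    obtain ⟨b, hb, d, hd0, hd1, hbd, hbd'⟩ := exists_diagonalize_pair h2 hε ⟨k, hk⟩ (g := a * g)
      (fun u v => by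
        rw [← mulVec_mulVec, ← mulVec_mulVec, formVal_mulVec_of_mem_closure h2 ha, hg])
      (fun i hi => by
        have hi : (i : ℕ) < k := hi
        have h1 : ¬ (i : ℕ) + 1 = m := by lia
        simpa [h1] using hac i hi)
    refine ⟨b * a, mul_mem hb.1 ha, d, hd0, fun h => hd1 (by simpa using h), fun i hi => ?_⟩
    rw [mul_assoc]
    rcases Nat.lt_succ_iff_lt_or_eq.1 hi with h | h
    · have h1 : ¬ (i : ℕ) + 1 = m := by lia
      rw [← mulVec_mulVec _ b (a * g), ← mulVec_mulVec _ b (a * g), (hac i h).1, (hac i h).2, mulVec_smul, mulVec_smul,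
        (hb.2 i h).1, (hb.2 i h).2]
      simp [h1]
    · obtain rfl : i = ⟨k, hk⟩ := Fin.ext h
      rw [hbd, hbd']
      by_cases h1 : k + 1 = m
      · simp [h1]
      · simp [h1, hd1 (lt_of_le_of_ne hk h1)]

lemma exists_isGaussianOutput (h2 : (2 : F) ≠ 0) {ε : F} (hε : ε ≠ 0)
    {g : Matrix (TwIdx m) (TwIdx m) F}
    (hg : ∀ u v, formVal (twistedForm ε m) (g *ᵥ u) (g *ᵥ v) = formVal (twistedForm ε m) u v) :
    ∃ (N : ℕ) (A₀ : Matrix (Fin 2) (Fin 2) F) (lam : Fˣ), IsGaussianOutput ε g N A₀ lam := by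
  obtain ⟨a, ha, c, hc0, hc1, hac⟩ := exists_elim h2 hε hg m le_rfl
  have hag : ∀ u v, formVal (twistedForm ε m) ((a * g) *ᵥ u) ((a * g) *ᵥ v) =
      formVal (twistedForm ε m) u v := fun u v => by
    rw [← mulVec_mulVec, ← mulVec_mulVec, formVal_mulVec_of_mem_closure h2 ha, hg]
  refine ⟨0, (a * g).toBlocks₁₁, Units.mk0 c hc0, fun hm => Units.ext (hc1 (.inr hm)), ?_⟩
  convert Reduces.mul_left ha (Reduces.refl (ε := ε) (g := g)) using 1
  generalize a * g = h at *
  have hentry : ∀ i j, h i j = (h *ᵥ Pi.single j 1) i := by simp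
  -- The images of `e_1`, `e_{-1}` stay orthogonal to those of `e_i`, `e_{-i}`, which are nonzero
  -- multiples of themselves; hence this block vanishes.
  have h21 : ∀ (b : Fin 2) (i : Fin m), h (idxPos i) (Sum.inl b) = 0 ∧
      h (idxNeg i) (Sum.inl b) = 0 := by
    intro b i
    have e1 := hag (Pi.single (idxPos i) 1) (Pi.single (Sum.inl b) 1)
    have e2 := hag (Pi.single (idxNeg i) 1) (Pi.single (Sum.inl b) 1)
    rw [(hac i i.2).1, formVal_smul_left, formVal_single_left, formVal_single_single,
      if_neg (show ¬ dualIdx (idxPos i) = Sum.inl b by simp [dualIdx]), ← hentry] at e1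
    rw [(hac i i.2).2, formVal_smul_left, formVal_single_left, formVal_single_single,
      if_neg (show ¬ dualIdx (idxNeg i) = Sum.inl b by simp [dualIdx]), ← hentry] at e2
    constructor
    · split_ifs at e2 <;> simpa [hc0, dualIdx] using e2
    · split_ifs at e1 <;> simpa [hc0, dualIdx] using e1
  ext i j
  rcases j with b | j | j
  · rcases i with i | i | i
    · rfl
    · simp [outputMatrix, (h21 b i).1]
    · simp [outputMatrix, (h21 b i).2]
  · rw [hentry i, (hac j j.2).1]
    rcases i with i | i | i
    · simp [outputMatrix]
    · by_cases hij : i = j <;> simp [outputMatrix, lastDiag, hij]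
    · simp [outputMatrix]
  · rw [hentry i, (hac j j.2).2]
    rcases i with i | i | i
    · simp [outputMatrix]
    · simp [outputMatrix]
    · by_cases hij : i = j <;> simp [outputMatrix, lastDiag, hij]

end Elimination

/-! ### Spinor norm of the block diagonal output. -/

section Output

variable {F : Type*} [Field F] {m : ℕ}

lemma outputMatrix_mul (A C : Matrix (Fin 2) (Fin 2) F) (lam : Fˣ) :
    (outputMatrix (A * C) lam : Matrix (TwIdx m) (TwIdx m) F) =
      outputMatrix A 1 * outputMatrix C lam := by
  simp [outputMatrix, fromBlocks_multiply, lastDiag]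

lemma outputMatrix_one_one :
    (outputMatrix 1 1 : Matrix (TwIdx m) (TwIdx m) F) = 1 := by
  simp [outputMatrix, lastDiag]

lemma det_outputMatrix (A : Matrix (Fin 2) (Fin 2) F) (lam : Fˣ) :
    (outputMatrix A lam : Matrix (TwIdx m) (TwIdx m) F).det = A.det := by
  have h : (lastDiag m (lam : F)).det * (lastDiag m ((lam⁻¹ : Fˣ) : F)).det = 1 := by
    rw [← det_mul, lastDiag, lastDiag, diagonal_mul_diagonal, det_diagonal]
    refine Finset.prod_eq_one fun i _ => ?_
    split_ifs <;> simp
  rw [outputMatrix, det_fromBlocks_zero₁₂, det_fromBlocks_zero₁₂, h, mul_one]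

lemma transpose_mul_mul_of_outputMatrix {ε : F} {A : Matrix (Fin 2) (Fin 2) F} {lam : Fˣ}
    (h : (outputMatrix A lam : Matrix (TwIdx m) (TwIdx m) F)ᵀ * twistedForm ε m *
      outputMatrix A lam = twistedForm ε m) :
    Aᵀ * !![1, 0; 0, ε] * A = !![1, 0; 0, ε] := by
  simpa [outputMatrix, twistedForm, fromBlocks_transpose, fromBlocks_multiply] using
    congrArg toBlocks₁₁ h

lemma formVal_twistedForm_inl (ε a b : F) (x : TwIdx m → F) :
    formVal (twistedForm ε m) (a • Pi.single (idxOne m) 1 + b • Pi.single (idxNegOne m) 1) x =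
      a * x (idxOne m) + ε * b * x (idxNegOne m) := by
  rw [formVal_add_left, formVal_smul_left, formVal_smul_left, formVal_single_left,
    formVal_single_left]
  simp [dualIdx, formWeight]
  ring

lemma formVal_twistedForm_inl_self (ε a b : F) :
    formVal (twistedForm ε m) (a • Pi.single (idxOne m) 1 + b • Pi.single (idxNegOne m) 1)
      (a • Pi.single (idxOne m) 1 + b • Pi.single (idxNegOne m) 1) = a ^ 2 + ε * b ^ 2 := by
  rw [formVal_twistedForm_inl]
  simp
  ring

lemma outputMatrix_mulVec_inl (A : Matrix (Fin 2) (Fin 2) F) (lam : Fˣ) (x : TwIdx m → F)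
    (a : Fin 2) : ((outputMatrix A lam : Matrix (TwIdx m) (TwIdx m) F) *ᵥ x) (Sum.inl a) =
      A a 0 * x (idxOne m) + A a 1 * x (idxNegOne m) := by
  simp [outputMatrix, mulVec, dotProduct, Fintype.sum_sum_type]

lemma outputMatrix_mulVec_idxPos (A : Matrix (Fin 2) (Fin 2) F) (lam : Fˣ) (x : TwIdx m → F)
    (i : Fin m) : ((outputMatrix A lam : Matrix (TwIdx m) (TwIdx m) F) *ᵥ x) (idxPos i) =
      (if (i : ℕ) + 1 = m then (lam : F) else 1) * x (idxPos i) := by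
  simp [outputMatrix, mulVec, dotProduct, Fintype.sum_sum_type, lastDiag, diagonal_apply]

lemma outputMatrix_mulVec_idxNeg (A : Matrix (Fin 2) (Fin 2) F) (lam : Fˣ) (x : TwIdx m → F)
    (i : Fin m) : ((outputMatrix A lam : Matrix (TwIdx m) (TwIdx m) F) *ᵥ x) (idxNeg i) =
      (if (i : ℕ) + 1 = m then (lam : F)⁻¹ else 1) * x (idxNeg i) := by
  simp [outputMatrix, mulVec, dotProduct, Fintype.sum_sum_type, lastDiag, diagonal_apply]

/-- The block sends `e_1` to `(t, s)`, so its mirror vector is the difference `(t-1, s)`, of norm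
`2(1-t)`. -/
lemma hasSpinorClass_reflection_block (h2 : (2 : F) ≠ 0) {ε t s : F}
    (hts : t ^ 2 + ε * s ^ 2 = 1) (ht : t ≠ 1) :
    HasSpinorClass (twistedForm ε m) (outputMatrix !![t, ε * s; s, -t] 1) (1 - t) := by
  have ht' : 1 - t ≠ 0 := sub_ne_zero.2 ht.symm
  have hself : formVal (twistedForm ε m)
      ((t - 1) • Pi.single (idxOne m) 1 + s • Pi.single (idxNegOne m) 1)
      ((t - 1) • Pi.single (idxOne m) 1 + s • Pi.single (idxNegOne m) 1) = 2 * (1 - t) := by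
    rw [formVal_twistedForm_inl_self]
    linear_combination hts
  have heq : (outputMatrix !![t, ε * s; s, -t] 1 : Matrix (TwIdx m) (TwIdx m) F) =
      reflectionMatrix (twistedForm ε m)
        ((t - 1) • Pi.single (idxOne m) 1 + s • Pi.single (idxNegOne m) 1) := by
    refine mulVec_ext fun x => ?_
    rw [reflectionMatrix_mulVec, hself, formVal_twistedForm_inl]
    ext i
    rcases i with i | i | i
    · rw [outputMatrix_mulVec_inl]
      fin_cases i
      · simp
        field_simp
        ring
      · simp
        field_simp
        linear_combination x (idxNegOne m) * hts
    · rw [outputMatrix_mulVec_idxPos]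
      simp
    · rw [outputMatrix_mulVec_idxNeg]
      simp
  rw [heq]
  convert hasSpinorClass_reflectionMatrix (by rw [hself]; exact mul_ne_zero h2 ht') using 1
  rw [hself]
  field_simp

/-- The mirror vector is `e_{-1}`, of norm `ε`, and `ε/2 = 2ε (1/2)²`. -/
lemma hasSpinorClass_diag_one_neg_one (h2 : (2 : F) ≠ 0) {ε : F} (hε : ε ≠ 0) :
    HasSpinorClass (twistedForm ε m) (outputMatrix !![1, 0; 0, -1] 1) (2 * ε) := by
  have hself : formVal (twistedForm ε m)
      ((0 : F) • Pi.single (idxOne m) 1 + (1 : F) • Pi.single (idxNegOne m) 1)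
      ((0 : F) • Pi.single (idxOne m) 1 + (1 : F) • Pi.single (idxNegOne m) 1) = ε := by
    rw [formVal_twistedForm_inl_self]
    ring
  have heq : (outputMatrix !![1, 0; 0, -1] 1 : Matrix (TwIdx m) (TwIdx m) F) =
      reflectionMatrix (twistedForm ε m)
        ((0 : F) • Pi.single (idxOne m) 1 + (1 : F) • Pi.single (idxNegOne m) 1) := by
    refine mulVec_ext fun x => ?_
    rw [reflectionMatrix_mulVec, hself, formVal_twistedForm_inl]
    ext i
    rcases i with i | i | i
    · rw [outputMatrix_mulVec_inl]
      fin_cases i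
      · simp
      · simp
        field_simp
        ring
    · rw [outputMatrix_mulVec_idxPos]
      simp
    · rw [outputMatrix_mulVec_idxNeg]
      simp
  rw [heq]
  refine (hasSpinorClass_reflectionMatrix (by rwa [hself])).of_eq_mul_sq 2⁻¹ (inv_ne_zero h2) ?_
  rw [hself]
  field_simp

/-- On the last hyperbolic plane, the reflection in `e + λf` followed by that in `e + f` is `diag(λ,
λ⁻¹)`; the classes are `λ` and 1. -/
lemma hasSpinorClass_outputMatrix_one (h2 : (2 : F) ≠ 0) (ε : F) (lam : Fˣ)
    (hlam : m = 0 → lam = 1) :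
    HasSpinorClass (twistedForm ε m) (outputMatrix 1 lam) (lam : F) := by
  by_cases hm : m = 0
  · rw [hlam hm, outputMatrix_one_one]
    exact hasSpinorClass_one _
  have hl : (lam : F) ≠ 0 := lam.ne_zero
  let k : Fin m := ⟨m - 1, by lia⟩
  have hk : ∀ i : Fin m, (i : ℕ) + 1 = m ↔ i = k := fun i => by simp [k, Fin.ext_iff]; lia
  have hr : ∀ c : F, c ≠ 0 → HasSpinorClass (twistedForm ε m) (reflectionMatrix (twistedForm ε m)
      (Pi.single (idxPos k) 1 + c • Pi.single (idxNeg k) 1)) c := fun c hc => by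
    convert hasSpinorClass_reflectionMatrix (B := twistedForm ε m)
      (u := Pi.single (idxPos k) 1 + c • Pi.single (idxNeg k) 1)
      (by rw [formVal_hyperbolic_self]; exact mul_ne_zero h2 hc) using 1
    rw [formVal_hyperbolic_self]
    field_simp
  have heq : (outputMatrix 1 lam : Matrix (TwIdx m) (TwIdx m) F) =
      reflectionMatrix (twistedForm ε m)
        (Pi.single (idxPos k) 1 + (1 : F) • Pi.single (idxNeg k) 1) *
      reflectionMatrix (twistedForm ε m)
        (Pi.single (idxPos k) 1 + (lam : F) • Pi.single (idxNeg k) 1) := by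
    refine mulVec_ext fun x => ?_
    rw [← mulVec_mulVec, reflectionMatrix_mulVec, reflectionMatrix_mulVec]
    simp only [formVal_hyperbolic_self]
    simp only [formVal_hyperbolic]
    ext i
    rcases i with i | i | i
    · rw [outputMatrix_mulVec_inl]
      obtain rfl | rfl : i = 0 ∨ i = 1 := by lia
      · simp
      · simp
    · rw [outputMatrix_mulVec_idxPos]
      simp only [hk]
      by_cases h : i = k
      · subst h
        simp
        field_simp
        ring
      · simp [h]
    · rw [outputMatrix_mulVec_idxNeg]
      simp only [hk]
      by_cases h : i = k
      · subst h
        simp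
        field_simp
        ring
      · simp [h]
  rw [heq]
  simpa using (hr 1 one_ne_zero).mul (hr lam hl)

end Output

/-! ### Binary orthogonal matrices and the main theorem. -/

lemma orthogonal_two_by_two {F : Type*} [Field F] {ε : F} {A : Matrix (Fin 2) (Fin 2) F}
    (h : Aᵀ * !![1, 0; 0, ε] * A = !![1, 0; 0, ε]) (hε : ε ≠ 0) :
    A 0 0 ^ 2 + ε * A 1 0 ^ 2 = 1 ∧ (A.det = 1 ∨ A.det = -1) ∧
      A = !![A 0 0, -(ε * A 1 0 * A.det); A 1 0, A 0 0 * A.det] := by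
  have h00 := congrFun (congrFun h 0) 0
  have h01 := congrFun (congrFun h 0) 1
  have hdet := congrArg det h
  simp only [det_mul, det_transpose, det_fin_two_of] at hdet
  simp [mul_apply, Fin.sum_univ_two] at h00 h01
  refine ⟨by linear_combination h00, ?_, ?_⟩
  · have : A.det ^ 2 = 1 := by
      apply mul_left_cancel₀ hε
      linear_combination hdet
    exact eq_or_eq_neg_of_sq_eq_sq _ _ (this.trans (one_pow 2).symm)
  · ext i j
    fin_cases i <;> fin_cases j
    · simp
    · simp [det_fin_two]
      linear_combination A 0 0 * h01 - A 0 1 * h00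
    · simp
    · simp [det_fin_two]
      linear_combination A 1 0 * h01 - A 1 1 * h00

theorem corollaryA2 {F : Type*} [Field F] [Finite F] (ε : F) (hε : ¬ IsSquare ε) (m : ℕ)
    (g : GL (TwIdx m) F) (hg : g ∈ twistedOrthogonalGroup ε m) :
    (∃ (N : ℕ) (A₀ : Matrix (Fin 2) (Fin 2) F) (lam : Fˣ), IsGaussianOutput ε g.val N A₀ lam) ∧
    ∀ (N : ℕ) (A₀ : Matrix (Fin 2) (Fin 2) F) (lam : Fˣ), IsGaussianOutput ε g.val N A₀ lam →
      (g.val.det = (-1) ^ N ∨ g.val.det = (-1) ^ (N + 1)) ∧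
      ∃ t s : F, t ^ 2 + ε * s ^ 2 = 1 ∧
        (g.val.det = (-1) ^ (N + 1) →
          A₀ = !![t, ε * s; s, -t] ∧
          (t ≠ 1 →
            spinorNorm (twistedForm ε m) g.val = sqCoset ((lam : F) * (1 - t))) ∧
          (t = 1 →
            spinorNorm (twistedForm ε m) g.val = sqCoset (2 * ε * (lam : F)))) ∧
        (g.val.det = (-1) ^ N →
          A₀ = !![t, -(ε * s); s, t] ∧
          (t ≠ 1 →
            spinorNorm (twistedForm ε m) g.val = sqCoset (2 * ε * (lam : F) * (1 - t))) ∧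
          (t = 1 →
            spinorNorm (twistedForm ε m) g.val = sqCoset (lam : F))) := by
  -- In a finite field of characteristic two every element is a square.
  have h2 : (2 : F) ≠ 0 := fun h => hε (by
    have : ringChar F = 2 := by
      have h' : ((2 : ℕ) : F) = 0 := by exact_mod_cast h
      have hd := (ringChar.spec F 2).1 h'
      exact ((Nat.dvd_prime Nat.prime_two).1 hd).resolve_left CharP.ringChar_ne_one
    exact FiniteField.isSquare_of_char_two this ε)
  have hε0 : ε ≠ 0 := by
    rintro rfl
    exact hε IsSquare.zero
  have h11 : (-1 : F) ≠ 1 := fun h => h2 (by linear_combination -h)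
  have hiso := transpose_mul_mul_eq_iff.1 hg
  refine ⟨exists_isGaussianOutput h2 hε0 hiso, ?_⟩
  rintro N A lam ⟨hlam, hred⟩
  have hA := transpose_mul_mul_of_outputMatrix
    (transpose_mul_mul_eq_iff.2 (hred.formVal_mulVec h2 hiso))
  obtain ⟨hts, hdet, hAeq⟩ := orthogonal_two_by_two hA hε0
  have hdetA := hred.det_eq h2 hε0
  rw [det_outputMatrix] at hdetA
  have hgdet : g.val.det = (-1) ^ N * A.det := by
    rw [hdetA, ← mul_assoc, ← mul_pow]
    simp
  have hspin : ∀ c, HasSpinorClass (twistedForm ε m) (outputMatrix A 1) c →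
      spinorNorm (twistedForm ε m) g.val = sqCoset (c * lam) := fun c hc =>
    (hred.hasSpinorClass h2 hε0 (by
      have := hc.mul (hasSpinorClass_outputMatrix_one h2 ε lam hlam)
      rwa [← outputMatrix_mul, mul_one] at this)).spinorNorm_eq h2 (twistedForm_isSymm ε m)
  have hs0 : A 0 0 = 1 → A 1 0 = 0 := fun h => by
    rw [h] at hts
    have : ε * A 1 0 ^ 2 = 0 := by linear_combination hts
    simpa [hε0] using this
  have hpow : ((-1 : F)) ^ N ≠ 0 := pow_ne_zero _ (neg_ne_zero.2 one_ne_zero)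
  refine ⟨?_, A 0 0, A 1 0, hts, fun hN => ?_, fun hN => ?_⟩
  · rcases hdet with h | h
    · left; rw [hgdet, h, mul_one]
    · right; rw [hgdet, h, pow_succ]
  · have hd : A.det = -1 := mul_left_cancel₀ hpow (by rw [← hgdet, hN, pow_succ])
    rw [hd] at hAeq
    have hAeq' : A = !![A 0 0, ε * A 1 0; A 1 0, -A 0 0] := by simpa using hAeq
    refine ⟨hAeq', fun ht => ?_, fun ht => ?_⟩
    · rw [mul_comm]
      refine hspin _ ?_
      rw [hAeq']
      exact hasSpinorClass_reflection_block h2 hts ht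
    · refine hspin _ ?_
      rw [hAeq', ht, hs0 ht, mul_zero]
      exact hasSpinorClass_diag_one_neg_one h2 hε0
  · have hd : A.det = 1 := mul_left_cancel₀ hpow (by rw [← hgdet, hN, mul_one])
    rw [hd] at hAeq
    have hAeq' : A = !![A 0 0, -(ε * A 1 0); A 1 0, A 0 0] := by simpa using hAeq
    refine ⟨hAeq', fun ht => ?_, fun ht => ?_⟩
    · have hmul : A = !![A 0 0, ε * A 1 0; A 1 0, -A 0 0] * !![1, 0; 0, -1] := by
        rw [hAeq']
        simp
      rw [show 2 * ε * (lam : F) * (1 - A 0 0) = (1 - A 0 0) * (2 * ε) * lam by ring]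
      refine hspin _ ?_
      rw [hmul, outputMatrix_mul, ← hmul]
      exact (hasSpinorClass_reflection_block h2 hts ht).mul
        (hasSpinorClass_diag_one_neg_one h2 hε0)
    · have hA1 : A = 1 := by
        rw [hAeq', ht, hs0 ht]
        ext i j
        fin_cases i <;> fin_cases j <;> simp
      rw [← one_mul (lam : F)]
      refine hspin _ ?_
      rw [hA1, outputMatrix_one_one]
      exact hasSpinorClass_one _
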